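/- Let $L$ be a finite simplicial complex on a vertex set $\mathsf{V}$ (every $v\in\mathsf{V}$ is a vertex of $L$). Let $T_L$ be its toric complex, i.e. the subcomplex of the torus $(S^1)^{\mathsf{V}}$, with the standard CW-decomposition, that has one $i$-cell for each simplex of $L$ with $i$ vertices (including the empty simplex, for $i=0$). Its fundamental group $G_L=\pi_1(T_L)$ is the right-angled Artin group with one generator for each $v\in\mathsf{V}$ and one relation $vw=wv$ for each edge $\{v,w\}$ of $L$. Let $\nu\colon G_L\twoheadrightarrow\mathbb{Z}^r$ be an epimorphism ($r\ge 0$), let $T_L^{\nu}\to T_L$ be the corresponding regular cover with deck group $\mathbb{Z}^r$, equipped with the lifted cell structure, and let $\nu^*\colon H^1(\mathbb{Z}^r,\mathbb{Q})\to H^1(G_L,\mathbb{Q})$ be the induced homomorphism, where $H^1(G,\mathbb{Q})=\mathrm{Hom}(G,\mathbb{Q})$. Identify $H^1(G_L,\mathbb{Q})$ with $\mathbb{Q}^{\mathsf{V}}$ through the values on the generators, and for $\mathsf{W}\subseteq\mathsf{V}$ let $\mathbb{Q}^{\mathsf{W}}$ be the coordinate subspace of the classes that vanish on all generators $v\notin\mathsf{W}$.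 Let $\Bbbk$ be a field, and let $\Bbbk\langle L\rangle$ be the exterior Stanley–Reisner ring of $L$: the quotient of the exterior algebra over $\Bbbk$ on generators $v^*$ ($v\in\mathsf{V}$) by the ideal generated by the monomials $\prod_{v\in\sigma}v^*$ of the missing faces $\sigma\notin L$. For $\mathsf{W}\subseteq\mathsf{V}$ put $z_{\mathsf{W}}=\sum_{v\in\mathsf{W}}v^*$, and let $\beta_i(\Bbbk\langle L\rangle,z_{\mathsf{W}})$ be the dimension over $\Bbbk$ of the $i$-th cohomology of the complex $\Bbbk\langle L\rangle^0\to\Bbbk\langle L\rangle^1\to\Bbbk\langle L\rangle^2\to\cdots$ whose maps are multiplication by $z_{\mathsf{W}}$. Then, for each $q\ge 0$, the following are equivalent: 1. $\dim_{\Bbbk} H_i(T_L^{\nu},\Bbbk)<\infty$ for all $0\le i\le q$, where the (cellular) homology is taken with respect to the lifted cell structure. 2. $\mathrm{im}(\nu^*)\cap\mathbb{Q}^{\mathsf{W}}=\{0\}$ for every $\mathsf{W}\subseteq\mathsf{V}$ such that $\beta_i(\Bbbk\langle L\rangle,z_{\mathsf{W}})\ne 0$ for some $0\le i\le q$. -/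

import Mathlib

universe u v w

noncomputable section

namespace ToricCover

/-! ### Precubical complexes and their cellular homology -/

/-- A precubical complex: a combinatorial cell complex glued from the cubes `[0,1]^n`.
`cells n` is the set of `n`-dimensional cubes. For an `n`-cube with coordinates `x_0, …, x_{n-1}`,
`lower i` and `upper i` are the faces `x_i = 0` and `x_i = 1`, with the remaining coordinates in
the same order. The identities say that two successive face operations in different coordinate
directions can be interchanged. -/
structure PrecubicalComplex where
  cells : ℕ → Type u
  lower : ∀ {n : ℕ}, Fin (n + 1) → cells (n + 1) → cells n
  upper : ∀ {n : ℕ}, Fin (n + 1) → cells (n + 1) → cells n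
  lower_lower : ∀ {n : ℕ} (i j : Fin (n + 1)), i ≤ j → ∀ c : cells (n + 2),
    lower i (lower j.succ c) = lower j (lower i.castSucc c)
  lower_upper : ∀ {n : ℕ} (i j : Fin (n + 1)), i ≤ j → ∀ c : cells (n + 2),
    lower i (upper j.succ c) = upper j (lower i.castSucc c)
  upper_lower : ∀ {n : ℕ} (i j : Fin (n + 1)), i ≤ j → ∀ c : cells (n + 2),
    upper i (lower j.succ c) = lower j (upper i.castSucc c)
  upper_upper : ∀ {n : ℕ} (i j : Fin (n + 1)), i ≤ j → ∀ c : cells (n + 2),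
    upper i (upper j.succ c) = upper j (upper i.castSucc c)

namespace PrecubicalComplex

variable (X : PrecubicalComplex.{u}) (k : Type w) [Field k]

/-- The difference (upper face) - (lower face) in the `i`-th coordinate direction, on chains. -/
def faceDiff {n : ℕ} (i : Fin (n + 1)) : (X.cells (n + 1) →₀ k) →ₗ[k] (X.cells n →₀ k) :=
  Finsupp.lmapDomain k k (X.upper i) - Finsupp.lmapDomain k k (X.lower i)

/-- The cellular boundary `∂ c = ∑_i (-1)^i (upper_i c - lower_i c)`. -/
def boundary (n : ℕ) : (X.cells (n + 1) →₀ k) →ₗ[k] (X.cells n →₀ k) :=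
  ∑ i : Fin (n + 1), (-1 : k) ^ (i : ℕ) • X.faceDiff k i

theorem faceDiff_single {n : ℕ} (i : Fin (n + 1)) (c : X.cells (n + 1)) (t : k) :
    X.faceDiff k i (Finsupp.single c t) =
      Finsupp.single (X.upper i c) t - Finsupp.single (X.lower i c) t := by
  simp [faceDiff, Finsupp.mapDomain_single]

theorem faceDiff_comp {n : ℕ} (i j : Fin (n + 1)) (h : i ≤ j) :
    X.faceDiff k i ∘ₗ X.faceDiff k j.succ = X.faceDiff k j ∘ₗ X.faceDiff k i.castSucc := by
  ext1 c
  ext1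
  simp only [LinearMap.comp_apply, Finsupp.lsingle_apply, faceDiff_single, map_sub,
    X.lower_lower i j h, X.lower_upper i j h, X.upper_lower i j h, X.upper_upper i j h]
  abel

theorem boundary_comp (n : ℕ) : X.boundary k n ∘ₗ X.boundary k (n + 1) = 0 := by
  have expand : X.boundary k n ∘ₗ X.boundary k (n + 1) =
      ∑ p : Fin (n + 1) × Fin (n + 2), ((-1 : k) ^ ((p.1 : ℕ) + (p.2 : ℕ))) •
        (X.faceDiff k p.1 ∘ₗ X.faceDiff k p.2) := by
    rw [Fintype.sum_prod_type]
    ext1 c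
    ext1
    simp only [boundary, LinearMap.comp_apply, LinearMap.sum_apply, LinearMap.smul_apply, map_sum,
      map_smul, smul_smul, Finset.smul_sum, pow_add]
    rw [Finset.sum_comm]
    simp only [mul_comm]
  have cancel : ∀ i j : Fin (n + 1), i ≤ j →
      ((-1 : k) ^ ((i : ℕ) + (j.succ : ℕ))) • (X.faceDiff k i ∘ₗ X.faceDiff k j.succ) +
      ((-1 : k) ^ ((j : ℕ) + (i.castSucc : ℕ))) • (X.faceDiff k j ∘ₗ X.faceDiff k i.castSucc)
        = 0 := by
    intro i j h
    rw [X.faceDiff_comp k i j h, ← add_smul, Fin.val_succ, Fin.val_castSucc,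
      show (i : ℕ) + (j + 1) = (j + i) + 1 by omega, pow_succ, mul_neg_one, neg_add_cancel,
      zero_smul]
  rw [expand]
  refine Finset.sum_involution
    (fun p _ => if h : (p.2 : ℕ) ≤ (p.1 : ℕ)
      then ((⟨p.2, by omega⟩ : Fin (n + 1)), p.1.succ)
      else ((⟨(p.2 : ℕ) - 1, by omega⟩ : Fin (n + 1)), p.1.castSucc)) ?_ ?_ ?_ ?_
  · rintro ⟨i, j⟩ -
    by_cases h : (j : ℕ) ≤ (i : ℕ)
    · rw [dif_pos h]
      exact (add_comm _ _).trans (cancel ⟨j, by omega⟩ i h)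
    · rw [dif_neg h]
      have hj : j = Fin.succ (⟨(j : ℕ) - 1, by omega⟩ : Fin (n + 1)) := by
        ext
        simp
        omega
      have := cancel i ⟨(j : ℕ) - 1, by omega⟩ (by simp [Fin.le_def]; omega)
      rw [← hj] at this
      exact this
  · rintro ⟨i, j⟩ - - e
    by_cases h : (j : ℕ) ≤ (i : ℕ)
    · rw [dif_pos h, Prod.ext_iff, Fin.ext_iff, Fin.ext_iff] at e
      simp at e
      omega
    · rw [dif_neg h, Prod.ext_iff, Fin.ext_iff, Fin.ext_iff] at e
      simp at e
      omega
  · intros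
    exact Finset.mem_univ _
  · rintro ⟨i, j⟩ -
    by_cases h : (j : ℕ) ≤ (i : ℕ)
    · simp only [dif_pos h]
      rw [dif_neg (by simp; omega)]
      rfl
    · simp only [dif_neg h]
      rw [dif_pos (by simp; omega)]
      ext
      · rfl
      · simp
        omega

/-- The cellular chain complex of a precubical complex with coefficients in `k`. -/
def chainComplex : ChainComplex (ModuleCat.{max u w} k) ℕ :=
  ChainComplex.of (fun n => ModuleCat.of k (X.cells n →₀ k))
    (fun n => ModuleCat.ofHom (X.boundary k n))
    (fun n => by
      rw [← ModuleCat.ofHom_comp, X.boundary_comp k n]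
      rfl)

/-- The cellular homology `H_i(X, k)`. -/
def homology (i : ℕ) : ModuleCat.{max u w} k :=
  (X.chainComplex k).homology i

/-- A covering of precubical complexes: a dimension-preserving map compatible with all face
operations such that, whenever a cell `c` of the base has a face `x_i = 0` (or `x_i = 1`) and a
lift of this face is given, there is exactly one lift of `c` with that face. -/
structure IsCovering {E : PrecubicalComplex.{u}} {B : PrecubicalComplex.{v}}
    (p : ∀ {n : ℕ}, E.cells n → B.cells n) : Prop where
  map_lower : ∀ {n : ℕ} (i : Fin (n + 1)) (e : E.cells (n + 1)), p (E.lower i e) = B.lower i (p e)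
  map_upper : ∀ {n : ℕ} (i : Fin (n + 1)) (e : E.cells (n + 1)), p (E.upper i e) = B.upper i (p e)
  lift_lower : ∀ {n : ℕ} (i : Fin (n + 1)) (f : E.cells n) (c : B.cells (n + 1)),
    p f = B.lower i c → ∃! e : E.cells (n + 1), p e = c ∧ E.lower i e = f
  lift_upper : ∀ {n : ℕ} (i : Fin (n + 1)) (f : E.cells n) (c : B.cells (n + 1)),
    p f = B.upper i c → ∃! e : E.cells (n + 1), p e = c ∧ E.upper i e = f

end PrecubicalComplex

/-! ### The toric complex, its fundamental group and its covers -/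

section Toric

variable {V : Type u} (L : AbstractSimplicialComplex V)

/-- The simplices of `L`, the empty one included. -/
def IsSimplex (σ : Finset V) : Prop := σ = ∅ ∨ σ ∈ L.faces

variable {L} in
theorem IsSimplex.mono {σ τ : Finset V} (h : IsSimplex L σ) (hτ : τ ⊆ σ) : IsSimplex L τ := by
  rcases τ.eq_empty_or_nonempty with rfl | hne
  · exact Or.inl rfl
  · rcases h with rfl | h
    · exact absurd (Finset.subset_empty.mp hτ) hne.ne_empty
    · exact Or.inr ((L.isRelLowerSet_faces h).2 hτ hne)

variable [LinearOrder V]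

/-- The simplices of `L` with exactly `n` vertices (dimension `n - 1`), each written as the
increasing sequence of its vertices. -/
def OrderedSimplex (n : ℕ) : Type u :=
  {s : Fin n ↪o V // IsSimplex L (Finset.univ.map s.toEmbedding)}

variable {L}

/-- Delete the `i`-th vertex of a simplex. -/
def OrderedSimplex.delete {n : ℕ} (i : Fin (n + 1)) (s : OrderedSimplex L (n + 1)) :
    OrderedSimplex L n :=
  ⟨(Fin.succAboveOrderEmb i).trans s.1, s.2.mono (by intro; simp; rintro j rfl; exact ⟨_, rfl⟩)⟩

/-- The `i`-th vertex of a simplex. -/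
def OrderedSimplex.vertex {n : ℕ} (s : OrderedSimplex L n) (i : Fin n) : V := s.1 i

theorem OrderedSimplex.vertex_delete {n : ℕ} (i : Fin (n + 1)) (s : OrderedSimplex L (n + 1))
    (j : Fin n) : (s.delete i).vertex j = s.vertex (i.succAbove j) := rfl

theorem OrderedSimplex.delete_delete {n : ℕ} (i j : Fin (n + 1)) (h : i ≤ j)
    (s : OrderedSimplex L (n + 2)) :
    (s.delete j.succ).delete i = (s.delete i.castSucc).delete j := by
  apply Subtype.ext
  ext m
  change s.1 (j.succ.succAbove (i.succAbove m)) = s.1 (i.castSucc.succAbove (j.succAbove m))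
  congr 1
  ext
  simp only [Fin.succAbove, Fin.lt_def, Fin.le_def] at h ⊢
  grind

variable (L)

/-- The toric complex `T_L`: the subcomplex of the torus `(S¹)^V` with one `n`-cell for each
simplex of `L` with `n` vertices. The cell of `σ` is the cube `[0,1]^σ` with opposite faces glued:
both faces in the direction of `v ∈ σ` are the cell of `σ \ {v}`. -/
def toricComplex : PrecubicalComplex.{u} where
  cells := OrderedSimplex L
  lower i s := s.delete i
  upper i s := s.delete i
  lower_lower i j h s := s.delete_delete i j h
  lower_upper i j h s := s.delete_delete i j h
  upper_lower i j h s := s.delete_delete i j h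
  upper_upper i j h s := s.delete_delete i j h

/-- The defining relators of `G_L`: the commutators of the pairs of adjacent vertices. -/
def raagRelators : Set (FreeGroup V) :=
  {g | ∃ v w : V, v ≠ w ∧ ({v, w} : Finset V) ∈ L.faces ∧
    g = FreeGroup.of v * FreeGroup.of w * (FreeGroup.of v)⁻¹ * (FreeGroup.of w)⁻¹}

/-- The fundamental group `G_L = π₁(T_L)`: the right-angled Artin group of the 1-skeleton of `L`,
with one generator for each vertex (the loop around the corresponding 1-cell) and one commutation
relation for each edge (the attaching map of the corresponding 2-cell). -/
abbrev ToricGroup : Type u := PresentedGroup (raagRelators L)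

variable {L}

/-- The generator of `G_L` given by a vertex. -/
def gen (v : V) : ToricGroup L := PresentedGroup.of v

theorem gen_mul_gen {n : ℕ} (s : OrderedSimplex L n) (i j : Fin n) :
    (gen (s.vertex i) : ToricGroup L) * gen (s.vertex j) =
      gen (s.vertex j) * gen (s.vertex i) := by
  by_cases hij : s.vertex i = s.vertex j
  · rw [hij]
  · have hmem : ({s.vertex i, s.vertex j} : Finset V) ∈ L.faces := by
      have := s.2.mono (τ := {s.vertex i, s.vertex j}) (by
        intro x
        simp only [Finset.mem_insert, Finset.mem_singleton, Finset.mem_map, Finset.mem_univ,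
          true_and]
        rintro (rfl | rfl)
        exacts [⟨_, rfl⟩, ⟨_, rfl⟩])
      rcases this with h | h
      · simp at h
      · exact h
    have := PresentedGroup.one_of_mem (rels := raagRelators L) ⟨_, _, hij, hmem, rfl⟩
    simp only [map_mul, map_inv] at this
    exact mul_inv_eq_iff_eq_mul.mp (mul_inv_eq_one.mp this)

variable {H : Type v} [Group H]

/-- The Galois cover `T_L^ν → T_L` of a homomorphism `ν : G_L → H` (connected when `ν` is
surjective), with the lifted cell structure. Its `n`-cells are the translates `h • σ`, `h ∈ H`, of
the `n`-cells `σ` of `T_L`. The lift of the 1-cell of `v` that starts at the vertex `h` ends at the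
vertex `h * ν v`; in general the faces of `h • σ` in the direction of `v ∈ σ` are `h • (σ \ {v})`
and `(h * ν v) • (σ \ {v})`. The group `H` acts by left translation. -/
def toricCover (ν : ToricGroup L →* H) : PrecubicalComplex.{max u v} where
  cells n := H × OrderedSimplex L n
  lower i c := (c.1, c.2.delete i)
  upper i c := (c.1 * ν (gen (c.2.vertex i)), c.2.delete i)
  lower_lower i j h c := by simp only [c.2.delete_delete i j h]
  lower_upper i j h c := by
    simp only [c.2.delete_delete i j h, OrderedSimplex.vertex_delete,
      Fin.succAbove_castSucc_of_le i j h]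
  upper_lower i j h c := by
    simp only [c.2.delete_delete i j h, OrderedSimplex.vertex_delete,
      Fin.succAbove_succ_of_le j i h]
  upper_upper i j h c := by
    simp only [c.2.delete_delete i j h, OrderedSimplex.vertex_delete, mul_assoc, ← map_mul,
      Fin.succAbove_succ_of_le j i h, Fin.succAbove_castSucc_of_le i j h, gen_mul_gen]

theorem toricCover_isCovering (ν : ToricGroup L →* H) :
    PrecubicalComplex.IsCovering (E := toricCover ν) (B := toricComplex L) (fun c => c.2) where
  map_lower _ _ := rfl
  map_upper _ _ := rfl
  lift_lower i f c h := ⟨(f.1, c), ⟨rfl, Prod.ext rfl h.symm⟩, by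
    rintro ⟨g, _⟩ ⟨rfl, rfl⟩
    rfl⟩
  lift_upper i f c h := ⟨(f.1 * (ν (gen (c.vertex i)))⁻¹, c),
    ⟨rfl, Prod.ext (inv_mul_cancel_right _ _) h.symm⟩, by
      rintro ⟨g, _⟩ ⟨rfl, rfl⟩
      exact Prod.ext (mul_inv_cancel_right _ _).symm rfl⟩

end Toric

/-! ### First cohomology with rational coefficients -/

/-- `H¹(G, ℚ) = Hom(G, ℚ)`. -/
abbrev H1 (G : Type*) [Group G] : Type _ := Additive G →+ ℚ

/-- The map `ν^* : H¹(H, ℚ) → H¹(G, ℚ)` induced by a homomorphism `ν : G → H`. -/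
def H1.pullback {G H : Type*} [Group G] [Group H] (ν : G →* H) : H1 H →ₗ[ℚ] H1 G where
  toFun φ := φ.comp ν.toAdditive
  map_add' _ _ := rfl
  map_smul' _ _ := rfl

/-- The coordinate subspace `ℚ^W` of `H¹(G_L, ℚ) = ℚ^V`. The coordinates of a class `φ` are its
values on the generators, and `ℚ^W` consists of the classes with zero coordinates outside `W`. -/
def coordSubspace {V : Type u} [LinearOrder V] (L : AbstractSimplicialComplex V) (W : Finset V) :
    Submodule ℚ (H1 (ToricGroup L)) where
  carrier := {φ | ∀ v ∉ W, φ (Additive.ofMul (gen v)) = 0}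
  zero_mem' _ _ := rfl
  add_mem' ha hb v hv := by simp [ha v hv, hb v hv]
  smul_mem' c x hx v hv := by simp [hx v hv]

/-! ### The exterior Stanley–Reisner ring and Aomoto–Betti numbers -/

section StanleyReisner

variable (k : Type w) [Field k] {V : Type u} [LinearOrder V] (L : AbstractSimplicialComplex V)

/-- The monomial `v_1^* ∧ ⋯ ∧ v_n^*` of a vertex set `v_1 < ⋯ < v_n`, in the exterior algebra on
the free vector space with basis `v^*`, `v ∈ V`. -/
def monomial (σ : Finset V) : ExteriorAlgebra k (V →₀ k) :=
  ((σ.sort (· ≤ ·)).map fun v => ExteriorAlgebra.ι k (Finsupp.single v (1 : k))).prod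

/-- The relations of `k⟨L⟩`: the monomials of the missing faces of `L` are zero. -/
inductive missingFaceRel : ExteriorAlgebra k (V →₀ k) → ExteriorAlgebra k (V →₀ k) → Prop
  | missing (σ : Finset V) (hσ : ¬ IsSimplex L σ) : missingFaceRel (monomial k σ) 0

/-- The exterior Stanley–Reisner ring `k⟨L⟩`: the quotient of the exterior algebra by the two-sided
ideal generated by the monomials of the missing faces. -/
abbrev ExteriorSR : Type (max u w) := RingQuot (missingFaceRel k L)

/-- The homogeneous component `k⟨L⟩^i`. -/
def ExteriorSR.component (i : ℕ) : Submodule k (ExteriorSR k L) :=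
  (⋀[k]^i (V →₀ k)).map (RingQuot.mkAlgHom k (missingFaceRel k L)).toLinearMap

/-- `z_W = ∑_{v ∈ W} v^*`. -/
def ExteriorSR.zW (W : Finset V) : ExteriorSR k L :=
  ∑ v ∈ W, RingQuot.mkAlgHom k (missingFaceRel k L)
    (ExteriorAlgebra.ι k (Finsupp.single v (1 : k)))

end StanleyReisner

section Aomoto

variable {k : Type*} [Field k] {A : Type*} [Ring A] [Algebra k A]

/-- Degree `i` cocycles of the complex `A⁰ → A¹ → A² → ⋯`, with maps `x ↦ x * a`. -/
def aomotoCocycles (𝒜 : ℕ → Submodule k A) (a : A) (i : ℕ) : Submodule k A :=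
  𝒜 i ⊓ LinearMap.ker (LinearMap.mulRight k a)

/-- Degree `i` coboundaries of the same complex. -/
def aomotoCoboundaries (𝒜 : ℕ → Submodule k A) (a : A) : ℕ → Submodule k A
  | 0 => ⊥
  | i + 1 => (𝒜 i).map (LinearMap.mulRight k a)

/-- The Aomoto–Betti number `β_i(A, a) = dim_k H^i(A, · a)`, for an algebra with homogeneous
components `𝒜 i` and an element `a` of degree one with `a * a = 0`. -/
def aomotoBetti (𝒜 : ℕ → Submodule k A) (a : A) (i : ℕ) : ℕ :=
  Module.finrank k (aomotoCocycles 𝒜 a i ⧸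
    (aomotoCoboundaries 𝒜 a i).submoduleOf (aomotoCocycles 𝒜 a i))

end Aomoto

end ToricCover

end

noncomputable section

namespace ToricCover

open scoped Matrix

set_option linter.unusedSectionVars false

/-! ### Partial contractions of complexes of free modules given by matrices -/

section MatrixComplex

variable {S : ℕ → Type u} [∀ n, Fintype (S n)] [∀ n, DecidableEq (S n)]
variable {A : Type v} [CommRing A] {B : Type w} [CommRing B]

/-! Let `Λ` be the group algebra `k[H]` of the deck group `H = ℤ^r`. The cellular complex of the
cover is a complex of finite free `Λ`-modules whose differential is a signed vertex deletion with
weight `ν(v) - 1` at the vertex `v` (`chainEquiv_boundary`). Over a field, rescaling the basis shows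
that such a complex depends only on the set `W` of vertices of nonzero weight
(`NullHomotopic.of_support_eq`). For weights equal to the indicator of `W`, its dual is the Aomoto
complex of `z_W`, up to signs. Hence the numbers `β_i` with `i ≤ q` all vanish exactly when the
indicator complex of `W` is contractible through degree `q` (`forall_aomotoBetti_eq_zero_iff`).
Contractions are compared over different rings by two facts: a scalar killing homology has a
null-homotopic power (`KillsHomology.exists_nullHomotopic`), and a null-homotopy of `d` lifts along
a ring surjection to a scalar over a power of `d` that kills homology
(`NullHomotopic.exists_killsHomology_of_surjective`).

Finiteness implies the subspace condition. A nonzero class `φ ∘ ν` supported in `W` has some `g`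
with `φ(g) ≠ 0`. Finite-dimensional homology is killed by `p(g)` for a monic `p`, and `φ` sends
`p(g)` to a nonzero element of the domain `k[ℚ]`. The weights over `k[ℚ]` vanish outside `W`. Adding
an indeterminate to the weights in `W` makes their support exactly `W`, and the lifting fact keeps a
nonzero killing scalar. Over the fraction field the complex is then contractible, and this descends
to `k`, so all `β_i` with `i ≤ q` vanish (`nullHomotopic_of_killsHomology`).

The subspace condition implies finiteness. Let `I` be the ideal of `Λ` killing the homology in
degrees `≤ q`, let `m ⊇ I` be maximal, and let `W` be the set of vertices of nonzero weight modulo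
`m`. If all `β_i` with `i ≤ q` vanished for `W`, a scalar outside `m` would kill the homology
(`exists_notMem_killsHomology`). So the condition applies to `W`, and by duality over `ℚ` a power of
each `g` lies in the subgroup generated by the `ν(v)` with `v ∉ W` (`exists_pow_mem_closure`), all
of which are `1` modulo `m`. One exponent works for all `m`, so `g^n - 1` is in the radical of `I`
by the Jacobson property. Then `Λ/I` is finite over `k`, and so is the homology, which is finitely
generated over `Λ` and killed by `I`. -/

/-- The composite `H ∘ D` through degree `n - 1`, which is zero in degree `0`. -/
def downUp (D : ∀ n, Matrix (S n) (S (n + 1)) A) (H : ∀ n, Matrix (S (n + 1)) (S n) A) :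
    ∀ n, Matrix (S n) (S n) A
  | 0 => 0
  | n + 1 => H n * D n

/-- The cycles of the complex with differentials `D`. -/
def IsCycle (D : ∀ n, Matrix (S n) (S (n + 1)) A) : ∀ n, (S n → A) → Prop
  | 0, _ => True
  | n + 1, z => D n *ᵥ z = 0

/-- The scalar `d` kills the homology in degrees `≤ q`. -/
def KillsHomology (D : ∀ n, Matrix (S n) (S (n + 1)) A) (q : ℕ) (d : A) : Prop :=
  ∀ n ≤ q, ∀ z, IsCycle D n z → ∃ y, D n *ᵥ y = d • z

/-- Multiplication by `d` is null-homotopic in degrees `≤ q`. -/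
def NullHomotopic (D : ∀ n, Matrix (S n) (S (n + 1)) A) (q : ℕ) (d : A) : Prop :=
  ∃ H : ∀ n, Matrix (S (n + 1)) (S n) A, ∀ n ≤ q, D n * H n + downUp D H n = d • 1

variable {D : ∀ n, Matrix (S n) (S (n + 1)) A} {q : ℕ} {d : A}

theorem NullHomotopic.killsHomology (h : NullHomotopic D q d) : KillsHomology D q d := by
  obtain ⟨H, hH⟩ := h
  intro n hn z hz
  refine ⟨H n *ᵥ z, ?_⟩
  have h0 : downUp D H n *ᵥ z = 0 := by
    cases n with
    | zero => simp [downUp]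
    | succ n =>
      change (H n * D n) *ᵥ z = 0
      rw [← Matrix.mulVec_mulVec, show D n *ᵥ z = 0 from hz, Matrix.mulVec_zero]
  have := congrArg (· *ᵥ z) (hH n hn)
  simpa [Matrix.add_mulVec, h0, Matrix.smul_mulVec] using this

theorem downUp_smul (H : ∀ n, Matrix (S (n + 1)) (S n) A) (c : A) (n : ℕ) :
    downUp D (fun m => c • H m) n = c • downUp D H n := by
  cases n <;> simp [downUp]

theorem downUp_congr {H H' : ∀ n, Matrix (S (n + 1)) (S n) A} {n : ℕ}
    (h : ∀ m < n, H m = H' m) : downUp D H n = downUp D H' n := by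
  cases n with
  | zero => rfl
  | succ n => simp [downUp, h n (Nat.lt_succ_self n)]

theorem downUp_mul_eq_zero (hD : ∀ n, D n * D (n + 1) = 0)
    (H : ∀ n, Matrix (S (n + 1)) (S n) A) (n : ℕ) : downUp D H n * D n = 0 := by
  cases n with
  | zero => simp [downUp]
  | succ n => simp [downUp, Matrix.mul_assoc, hD]

/-- A homotopy built below degree `p` gives `D H = d - downUp` one degree down, so `D (d - H D)`
equals `downUp * D`, which vanishes because `D D = 0`. -/
theorem isCycle_col_sub_downUp (hD : ∀ n, D n * D (n + 1) = 0)
    {H : ∀ n, Matrix (S (n + 1)) (S n) A} {p : ℕ} {d : A}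
    (hH : ∀ n < p, D n * H n + downUp D H n = d • 1) (j : S p) :
    IsCycle D p ((d • 1 - downUp D H p).col j) := by
  cases p with
  | zero => trivial
  | succ m =>
    have : D m * (d • 1 - downUp D H (m + 1)) = 0 := by
      have h1 : D m * H m = d • 1 - downUp D H m := eq_sub_of_add_eq (hH m (Nat.lt_succ_self m))
      change D m * (d • 1 - H m * D m) = 0
      rw [Matrix.mul_sub, ← Matrix.mul_assoc, h1, Matrix.sub_mul, downUp_mul_eq_zero hD]
      simp
    change D m *ᵥ _ = 0
    ext i
    exact congrFun (congrFun this i) j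

/-- The homotopy is built degree by degree, as for a contraction of an exact complex of free
modules. The columns of the remaining error are cycles, and making them boundaries costs one more
factor `d`. -/
theorem KillsHomology.exists_nullHomotopic (hD : ∀ n, D n * D (n + 1) = 0)
    (h : KillsHomology D q d) : ∃ N : ℕ, NullHomotopic D q (d ^ N) := by
  suffices ∀ p ≤ q + 1, ∃ N : ℕ, ∃ H : ∀ n, Matrix (S (n + 1)) (S n) A,
      ∀ n < p, D n * H n + downUp D H n = d ^ N • 1 by
    obtain ⟨N, H, hH⟩ := this (q + 1) le_rfl
    exact ⟨N, H, fun n hn => hH n (Nat.lt_succ_of_le hn)⟩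
  intro p
  induction p with
  | zero => exact fun _ => ⟨0, fun _ => 0, fun n hn => absurd hn (Nat.not_lt_zero n)⟩
  | succ p ih =>
    intro hp
    obtain ⟨N, H, hH⟩ := ih (by omega)
    choose Y hY using fun j => h p (by omega) _ (isCycle_col_sub_downUp hD hH j)
    -- The part already built is multiplied by `d`, so that all degrees carry the same exponent `N +
    -- 1`.
    let H' := Function.update (fun m => d • H m) p (Matrix.of fun i j => Y j i)
    have hne : ∀ m < p, H' m = d • H m := fun m hm => Function.update_of_ne hm.ne _ _
    have hdu : ∀ n ≤ p, downUp D H' n = d • downUp D H n := fun n hn => by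
      rw [← downUp_smul]
      exact downUp_congr fun m hm => hne m (by omega)
    refine ⟨N + 1, H', fun n hn => ?_⟩
    rw [hdu n (by omega)]
    rcases Nat.lt_succ_iff_lt_or_eq.mp hn with hn | rfl
    · rw [hne n hn, Matrix.mul_smul, ← smul_add, hH n hn, smul_smul, pow_succ']
    · have : D n * H' n = d • (d ^ N • 1 - downUp D H n) := by
        ext i j
        simp only [H', Function.update_self]
        exact congrFun (hY j) i
      rw [this, ← smul_add, sub_add_cancel, smul_smul, pow_succ']

theorem downUp_map (f : A →+* B) (H : ∀ n, Matrix (S (n + 1)) (S n) A) (n : ℕ) :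
    (downUp D H n).map f = downUp (fun m => (D m).map f) (fun m => (H m).map f) n := by
  cases n with
  | zero => exact Matrix.map_zero _ (map_zero f)
  | succ n => exact Matrix.map_mul

theorem map_smul_one (f : A →+* B) (d : A) (n : ℕ) :
    (d • (1 : Matrix (S n) (S n) A)).map f = f d • 1 := by
  ext i j
  simp [Matrix.one_apply, apply_ite f]

theorem NullHomotopic.map (f : A →+* B) (h : NullHomotopic D q d) :
    NullHomotopic (fun n => (D n).map f) q (f d) := by
  obtain ⟨H, hH⟩ := h
  refine ⟨fun n => (H n).map f, fun n hn => ?_⟩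
  rw [← downUp_map, ← Matrix.map_mul, ← Matrix.map_add _ (map_add f), hH n hn, map_smul_one]

theorem NullHomotopic.smul (c : A) (h : NullHomotopic D q d) : NullHomotopic D q (c * d) := by
  obtain ⟨H, hH⟩ := h
  exact ⟨fun n => c • H n, fun n hn => by
    rw [downUp_smul, Matrix.mul_smul, ← smul_add, hH n hn, smul_smul]⟩

/-- Lift the homotopy entrywise. The resulting `U = D H + H D` is a null-homotopic chain map over
`A` that reduces to `d`, so its determinants reduce to powers of `d`. Inverting `U` up to
determinants by adjugates turns these determinants into scalars that kill homology. -/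
theorem NullHomotopic.exists_killsHomology_of_surjective (hD : ∀ n, D n * D (n + 1) = 0)
    {f : A →+* B} (hf : Function.Surjective f) {d : B}
    (h : NullHomotopic (fun n => (D n).map f) q d) :
    ∃ c : A, ∃ N : ℕ, f c = d ^ N ∧ KillsHomology D q c := by
  obtain ⟨H₀, hH⟩ := h
  choose g hg using hf
  let H : ∀ n, Matrix (S (n + 1)) (S n) A := fun n => (H₀ n).map g
  have hHf : (fun n => (H n).map f) = H₀ := by
    ext n i j
    simp [H, hg]
  let U : ∀ n, Matrix (S n) (S n) A := fun n => D n * H n + downUp D H n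
  have hU : ∀ n ≤ q, (U n).map f = d • 1 := fun n hn => by
    simp only [U, Matrix.map_add _ (map_add f), Matrix.map_mul, downUp_map, hHf]
    rw [← hH n hn]
    simp [← hHf]
  have hcomm : ∀ n, D n * U (n + 1) = U n * D n := fun n => by
    simp only [U, Matrix.mul_add, Matrix.add_mul, downUp_mul_eq_zero hD, ← Matrix.mul_assoc, hD]
    simp [downUp, Matrix.mul_assoc]
  have hdet : ∀ n ≤ q, f (U n).det = d ^ Fintype.card (S n) := fun n hn => by
    rw [RingHom.map_det, RingHom.mapMatrix_apply, hU n hn, Matrix.det_smul, Matrix.det_one, mul_one]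
  refine ⟨∏ n ∈ Finset.range (q + 1), (U n).det,
    ∑ n ∈ Finset.range (q + 1), Fintype.card (S n), ?_, ?_⟩
  · rw [map_prod, ← Finset.prod_pow_eq_pow_sum]
    exact Finset.prod_congr rfl fun n hn => hdet n (by simpa [Nat.lt_succ_iff] using hn)
  intro n hn z hz
  suffices ∃ e, e ∣ ∏ n ∈ Finset.range (q + 1), (U n).det ∧ ∃ y, D n *ᵥ y = e • z by
    obtain ⟨e, ⟨t, ht⟩, y, hy⟩ := this
    exact ⟨t • y, by rw [Matrix.mulVec_smul, hy, smul_smul, ht, mul_comm]⟩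
  cases n with
  | zero =>
    refine ⟨(U 0).det, Finset.dvd_prod_of_mem _ (by simp), H 0 *ᵥ ((U 0).adjugate *ᵥ z), ?_⟩
    have : U 0 = D 0 * H 0 := by simp [U, downUp]
    rw [Matrix.mulVec_mulVec, ← this, Matrix.mulVec_mulVec, Matrix.mul_adjugate,
      Matrix.smul_mulVec, Matrix.one_mulVec]
  | succ n =>
    have hz' : D n *ᵥ z = 0 := hz
    -- The adjugates commute with `D` only up to determinants; the extra factor `(U n).det` makes
    -- `y` a cycle. Then `U y` is both the boundary of `H y` and a multiple of `z`.
    let y := (U n).det • ((U (n + 1)).adjugate *ᵥ z)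
    have hy : D n *ᵥ y = 0 := by
      have : (U n).det • (D n * (U (n + 1)).adjugate) =
          (U n).adjugate * ((U (n + 1)).det • D n) := by
        have h1 : D n * (U (n + 1) * (U (n + 1)).adjugate) = (U (n + 1)).det • D n := by
          simp [Matrix.mul_adjugate]
        rw [← h1, ← Matrix.mul_assoc (D n), hcomm, Matrix.mul_assoc (U n), ← Matrix.mul_assoc,
          Matrix.adjugate_mul, Matrix.smul_mul, Matrix.one_mul]
      rw [Matrix.mulVec_smul, Matrix.mulVec_mulVec, ← Matrix.smul_mulVec, this,
        ← Matrix.mulVec_mulVec, Matrix.smul_mulVec, hz']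
      simp
    refine ⟨(U n).det * (U (n + 1)).det, ?_, H (n + 1) *ᵥ y, ?_⟩
    · rw [← Finset.prod_pair (f := fun n => (U n).det) (Nat.succ_ne_self n).symm]
      refine Finset.prod_dvd_prod_of_subset _ _ _ fun m => ?_
      simp only [Finset.mem_insert, Finset.mem_singleton, Finset.mem_range]
      omega
    · have h1 : U (n + 1) *ᵥ y = D (n + 1) *ᵥ (H (n + 1) *ᵥ y) := by
        simp only [U, Matrix.add_mulVec, downUp]
        rw [← Matrix.mulVec_mulVec, ← Matrix.mulVec_mulVec, hy, Matrix.mulVec_zero, add_zero]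
      rw [← h1, Matrix.mulVec_smul, Matrix.mulVec_mulVec, Matrix.mul_adjugate,
        Matrix.smul_mulVec, Matrix.one_mulVec, smul_smul]

/-- Null-homotopies are transported along isomorphisms of complexes. -/
theorem NullHomotopic.of_conj {D' : ∀ n, Matrix (S n) (S (n + 1)) A}
    {E F : ∀ n, Matrix (S n) (S n) A} (hEF : ∀ n, E n * F n = 1)
    (hE : ∀ n, D n * E (n + 1) = E n * D' n) (h : NullHomotopic D q d) :
    NullHomotopic D' q d := by
  obtain ⟨H, hH⟩ := h
  have hFE : ∀ n, F n * E n = 1 := fun n => mul_eq_one_comm.mp (hEF n)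
  have hD' : ∀ n, D' n = F n * D n * E (n + 1) := fun n => by
    rw [Matrix.mul_assoc, hE, ← Matrix.mul_assoc, hFE, Matrix.one_mul]
  refine ⟨fun n => F (n + 1) * H n * E n, fun n hn => ?_⟩
  have h1 : D' n * (F (n + 1) * H n * E n) = F n * (D n * H n) * E n := by
    rw [hD', ← Matrix.mul_assoc, ← Matrix.mul_assoc, Matrix.mul_assoc _ (E (n + 1)), hEF,
      Matrix.mul_one, Matrix.mul_assoc (F n)]
  have h2 : downUp D' (fun n => F (n + 1) * H n * E n) n = F n * downUp D H n * E n := by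
    cases n with
    | zero => simp [downUp]
    | succ n =>
      simp only [downUp]
      rw [hD', ← Matrix.mul_assoc, ← Matrix.mul_assoc, Matrix.mul_assoc _ (E n), hEF,
        Matrix.mul_one, Matrix.mul_assoc (F _)]
  rw [h1, h2, ← Matrix.add_mul, ← Matrix.mul_add, hH n hn]
  simp [hFE]

/-- Contractibility of a complex over `A` can be tested after an extension `A → B` that has an
`A`-linear retraction. -/
theorem NullHomotopic.of_retraction [Algebra A B] (ρ : B →ₗ[A] A) (hρ : ρ 1 = 1)
    (h : NullHomotopic (fun n => (D n).map (algebraMap A B)) q 1) : NullHomotopic D q 1 := by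
  obtain ⟨H, hH⟩ := h
  -- The entries of `D` come from `A`, so the `A`-linear map `ρ` passes through products with `D` on
  -- either side, although it need not be multiplicative.
  have hleft : ∀ n, ((D n).map (algebraMap A B) * H n).map ρ = D n * (H n).map ρ := fun n => by
    ext i j
    simp [Matrix.mul_apply, ← Algebra.smul_def]
  have hright : ∀ n, (H n * (D n).map (algebraMap A B)).map ρ = (H n).map ρ * D n := fun n => by
    ext i j
    simp only [Matrix.map_apply, Matrix.mul_apply, map_sum]
    refine Finset.sum_congr rfl fun l _ => ?_
    rw [mul_comm, ← Algebra.smul_def, map_smul, smul_eq_mul, mul_comm]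
  refine ⟨fun n => (H n).map ρ, fun n hn => ?_⟩
  have h1 := congrArg (fun M => M.map ρ) (hH n hn)
  have h2 : downUp D (fun n => (H n).map ρ) n =
      (downUp (fun n => (D n).map (algebraMap A B)) H n).map ρ := by
    cases n with
    | zero => exact (Matrix.map_zero _ (map_zero ρ)).symm
    | succ n => exact (hright n).symm
  rw [h2, ← hleft, ← Matrix.map_add _ (map_add ρ)]
  refine h1.trans ?_
  ext i j
  simp [Matrix.one_apply, apply_ite ρ, hρ]

/-- Exactness of the dual complex in degrees `≤ q`. -/
def DualExact (D : ∀ n, Matrix (S n) (S (n + 1)) A) (q : ℕ) : Prop :=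
  (∀ c : S 0 → A, c ᵥ* D 0 = 0 → c = 0) ∧
    ∀ n < q, ∀ c : S (n + 1) → A, c ᵥ* D (n + 1) = 0 → ∃ b, c = b ᵥ* D n

theorem NullHomotopic.dualExact (h : NullHomotopic D q 1) : DualExact D q := by
  obtain ⟨H, hH⟩ := h
  constructor
  · intro c hc
    have h0 := congrArg (c ᵥ* ·) (hH 0 (Nat.zero_le q))
    simpa [downUp, ← Matrix.vecMul_vecMul, hc] using h0.symm
  · intro n hn c hc
    have h0 := congrArg (c ᵥ* ·) (hH (n + 1) hn)
    refine ⟨c ᵥ* H n, ?_⟩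
    simpa [downUp, Matrix.vecMul_add, ← Matrix.vecMul_vecMul, hc] using h0.symm

/-- The kernel condition makes `v ↦ v P` factor through the image of `v ↦ v M`; over a field the
factor extends from this subspace to the whole space. -/
theorem exists_mul_eq_of_vecMul {K : Type*} [Field K] {a b c : Type*} [Fintype a] [Fintype b]
    [Fintype c] [DecidableEq a] [DecidableEq b] [DecidableEq c]
    (M : Matrix a b K) (P : Matrix a c K) (h : ∀ v, v ᵥ* M = 0 → v ᵥ* P = 0) :
    ∃ N : Matrix b c K, M * N = P := by
  obtain ⟨g, hg⟩ := (LinearMap.exists_extend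
    ((M.vecMulLinear.ker.liftQ P.vecMulLinear (fun v hv => h v hv)).comp
      M.vecMulLinear.quotKerEquivRange.symm.toLinearMap))
  have hg' : ∀ v, g (v ᵥ* M) = v ᵥ* P := fun v => by
    have := LinearMap.congr_fun hg (M.vecMulLinear.quotKerEquivRange (Submodule.Quotient.mk v))
    simp only [LinearMap.comp_apply, LinearEquiv.coe_coe, LinearEquiv.symm_apply_apply] at this
    exact this
  refine ⟨LinearMap.toMatrixRight' g, ?_⟩
  apply Matrix.ext_of_single_vecMul
  intro i
  rw [← Matrix.vecMul_vecMul, ← hg']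
  exact LinearMap.congr_fun (Matrix.toLinearMapRight'.apply_symm_apply g) _

/-- Solving `D p * H p = 1 - downUp` only requires the left kernel of `D p` to annihilate the
right-hand side. By exactness this kernel comes from the previous differential, which the right-hand
side kills. -/
theorem DualExact.nullHomotopic {K : Type*} [Field K] {D : ∀ n, Matrix (S n) (S (n + 1)) K}
    (hD : ∀ n, D n * D (n + 1) = 0) (h : DualExact D q) : NullHomotopic D q 1 := by
  suffices ∀ p ≤ q + 1, ∃ H : ∀ n, Matrix (S (n + 1)) (S n) K,
      ∀ n < p, D n * H n + downUp D H n = 1 by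
    obtain ⟨H, hH⟩ := this (q + 1) le_rfl
    exact ⟨H, fun n hn => by rw [hH n (Nat.lt_succ_of_le hn), one_smul]⟩
  intro p
  induction p with
  | zero => exact fun _ => ⟨fun _ => 0, fun n hn => absurd hn (Nat.not_lt_zero n)⟩
  | succ p ih =>
    intro hp
    obtain ⟨H, hH⟩ := ih (by omega)
    obtain ⟨Y, hY⟩ := exists_mul_eq_of_vecMul (D p) (1 - downUp D H p) (by
      intro c hc
      cases p with
      | zero => rw [h.1 c hc, Matrix.zero_vecMul]
      | succ m =>
        obtain ⟨b, rfl⟩ := h.2 m (by omega) c hc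
        have h1 : D m * H m = 1 - downUp D H m := eq_sub_of_add_eq (hH m (Nat.lt_succ_self m))
        have h2 : D m * (1 - H m * D m) = 0 := by
          rw [Matrix.mul_sub, ← Matrix.mul_assoc, h1, Matrix.sub_mul, downUp_mul_eq_zero hD]
          simp
        change _ ᵥ* (1 - H m * D m) = 0
        rw [Matrix.vecMul_vecMul, h2, Matrix.vecMul_zero])
    let H' := Function.update H p Y
    have hne : ∀ m < p, H' m = H m := fun m hm => Function.update_of_ne hm.ne _ _
    have hdu : ∀ n ≤ p, downUp D H' n = downUp D H n := fun n hn =>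
      downUp_congr fun m hm => hne m (by omega)
    refine ⟨H', fun n hn => ?_⟩
    rw [hdu n (by omega)]
    rcases Nat.lt_succ_iff_lt_or_eq.mp hn with hn | rfl
    · rw [hne n hn, hH n hn]
    · simp only [H', Function.update_self, hY, sub_add_cancel]

end MatrixComplex

/-! ### The cellular complex of the torus with weights on the vertices -/

section ToricMatrix

variable {V : Type u} [Fintype V] [LinearOrder V] {L : AbstractSimplicialComplex V}
variable {A : Type v} [CommRing A] {B : Type w} [CommRing B]

theorem OrderedSimplex.ext_vertex {n : ℕ} {s t : OrderedSimplex L n}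
    (h : ∀ i, s.vertex i = t.vertex i) : s = t :=
  Subtype.ext (RelEmbedding.ext h)

instance OrderedSimplex.instFinite (n : ℕ) : Finite (OrderedSimplex L n) :=
  Finite.of_injective (fun s : OrderedSimplex L n => s.vertex)
    fun _ _ h => OrderedSimplex.ext_vertex (congrFun h)

instance OrderedSimplex.instFintype (n : ℕ) : Fintype (OrderedSimplex L n) := Fintype.ofFinite _

instance OrderedSimplex.instDecidableEq (n : ℕ) : DecidableEq (OrderedSimplex L n) :=
  Classical.decEq _

variable (L) in
/-- The differential `∂ t = ∑_i (-1)^i x(t_i) (t \ t_i)` with weights `x` on the vertices. -/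
def toricDiff (x : V → A) (n : ℕ) : Matrix (OrderedSimplex L n) (OrderedSimplex L (n + 1)) A :=
  fun s t => ∑ i : Fin (n + 1), if t.delete i = s then (-1) ^ (i : ℕ) * x (t.vertex i) else 0

/-- Deleting two vertices in either order gives the same term with opposite signs; the involution
exchanges the two orders. -/
theorem sum_alternating_eq_zero {n : ℕ} (f : Fin (n + 1) → Fin (n + 2) → A)
    (h : ∀ i j : Fin (n + 1), i ≤ j → f i j.succ = f j i.castSucc) :
    ∑ p : Fin (n + 1) × Fin (n + 2), (-1) ^ ((p.1 : ℕ) + (p.2 : ℕ)) * f p.1 p.2 = 0 := by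
  have cancel : ∀ i j : Fin (n + 1), i ≤ j →
      (-1) ^ ((i : ℕ) + (j.succ : ℕ)) * f i j.succ +
      (-1) ^ ((j : ℕ) + (i.castSucc : ℕ)) * f j i.castSucc = 0 := by
    intro i j hij
    rw [h i j hij, ← add_mul, Fin.val_succ, Fin.val_castSucc,
      show (i : ℕ) + (j + 1) = (j + i) + 1 by omega, pow_succ, mul_neg_one, neg_add_cancel,
      zero_mul]
  refine Finset.sum_involution
    (fun p _ => if h : (p.2 : ℕ) ≤ (p.1 : ℕ)
      then ((⟨p.2, by omega⟩ : Fin (n + 1)), p.1.succ)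
      else ((⟨(p.2 : ℕ) - 1, by omega⟩ : Fin (n + 1)), p.1.castSucc)) ?_ ?_ ?_ ?_
  · rintro ⟨i, j⟩ -
    by_cases h : (j : ℕ) ≤ (i : ℕ)
    · rw [dif_pos h]
      exact (add_comm _ _).trans (cancel ⟨j, by omega⟩ i h)
    · rw [dif_neg h]
      have hj : j = Fin.succ (⟨(j : ℕ) - 1, by omega⟩ : Fin (n + 1)) := by
        ext
        simp
        omega
      have := cancel i ⟨(j : ℕ) - 1, by omega⟩ (by simp [Fin.le_def]; omega)
      rw [← hj] at this
      exact this
  · rintro ⟨i, j⟩ - - e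
    by_cases h : (j : ℕ) ≤ (i : ℕ)
    · rw [dif_pos h, Prod.ext_iff, Fin.ext_iff, Fin.ext_iff] at e
      simp at e
      omega
    · rw [dif_neg h, Prod.ext_iff, Fin.ext_iff, Fin.ext_iff] at e
      simp at e
      omega
  · intros
    exact Finset.mem_univ _
  · rintro ⟨i, j⟩ -
    by_cases h : (j : ℕ) ≤ (i : ℕ)
    · simp only [dif_pos h]
      rw [dif_neg (by simp; omega)]
      rfl
    · simp only [dif_neg h]
      rw [dif_pos (by simp; omega)]
      ext
      · rfl
      · simp
        omega

theorem sum_mul_toricDiff (x : V → A) (n : ℕ) (c : OrderedSimplex L n → A)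
    (t : OrderedSimplex L (n + 1)) :
    ∑ s, c s * toricDiff L x n s t =
      ∑ i : Fin (n + 1), (-1) ^ (i : ℕ) * x (t.vertex i) * c (t.delete i) := by
  simp only [toricDiff, Finset.mul_sum]
  rw [Finset.sum_comm]
  refine Finset.sum_congr rfl fun i _ => ?_
  rw [Finset.sum_eq_single (t.delete i)]
  · rw [if_pos rfl, mul_comm]
  · intro s _ hs
    rw [if_neg (Ne.symm hs), mul_zero]
  · intro h
    exact absurd (Finset.mem_univ _) h

/-- These are the coefficients of left multiplication by `∑ x(v) v^*` in the basis of simplex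
monomials, which is why the dual of the toric complex is an Aomoto complex. -/
theorem vecMul_toricDiff (x : V → A) (n : ℕ) (c : OrderedSimplex L n → A)
    (t : OrderedSimplex L (n + 1)) :
    (c ᵥ* toricDiff L x n) t =
      ∑ i : Fin (n + 1), (-1) ^ (i : ℕ) * x (t.vertex i) * c (t.delete i) :=
  sum_mul_toricDiff x n c t

theorem toricDiff_mul_toricDiff (x : V → A) (n : ℕ) :
    toricDiff L x n * toricDiff L x (n + 1) = 0 := by
  ext s t
  rw [Matrix.mul_apply, sum_mul_toricDiff, Matrix.zero_apply,
    ← sum_alternating_eq_zero (n := n) (fun i j => if (t.delete j).delete i = s then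
      x (t.vertex j) * x ((t.delete j).vertex i) else 0), Fintype.sum_prod_type, Finset.sum_comm]
  · refine Finset.sum_congr rfl fun j _ => ?_
    rw [toricDiff, Finset.mul_sum]
    refine Finset.sum_congr rfl fun i _ => ?_
    split_ifs
    · ring
    · simp
  · intro i j hij
    simp only [t.delete_delete i j hij, OrderedSimplex.vertex_delete,
      Fin.succAbove_succ_of_le j i hij, Fin.succAbove_castSucc_of_le i j hij,
      mul_comm (x (t.vertex j.succ))]

theorem toricDiff_map (f : A →+* B) (x : V → A) (n : ℕ) :
    (toricDiff L x n).map f = toricDiff L (fun v => f (x v)) n := by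
  ext s t
  simp [toricDiff, apply_ite f]

theorem toricDiff_add (x y : V → A) (n : ℕ) :
    toricDiff L (x + y) n = toricDiff L x n + toricDiff L y n := by
  ext s t
  simp only [toricDiff, Matrix.add_apply, ← Finset.sum_add_distrib]
  refine Finset.sum_congr rfl fun i _ => ?_
  split_ifs <;> simp [mul_add]

theorem toricDiff_smul (a : A) (x : V → A) (n : ℕ) :
    toricDiff L (a • x) n = a • toricDiff L x n := by
  ext s t
  simp only [toricDiff, Matrix.smul_apply, smul_eq_mul, Finset.mul_sum]
  refine Finset.sum_congr rfl fun i _ => ?_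
  split_ifs
  · simp only [Pi.smul_apply, smul_eq_mul]; ring
  · simp

/-- Multiplying the weights by units does not change the complex up to isomorphism. -/
theorem NullHomotopic.rescale {x : V → A} {q : ℕ} {d : A} (a : V → Aˣ)
    (h : NullHomotopic (toricDiff L x) q d) :
    NullHomotopic (toricDiff L (fun v => a v * x v)) q d := by
  refine h.of_conj
    -- The basis vector of a simplex is scaled by the product of the units of its vertices; deleting
    -- a vertex removes exactly its own unit.
    (E := fun n => Matrix.diagonal fun s => ∏ j, (a (s.vertex j) : A))
    (F := fun n => Matrix.diagonal fun s => ∏ j, ((a (s.vertex j))⁻¹ : Aˣ)) ?_ ?_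
  · intro n
    rw [Matrix.diagonal_mul_diagonal, ← Matrix.diagonal_one]
    congr 1
    ext s
    simp [← Finset.prod_mul_distrib]
  · intro n
    ext s t
    rw [Matrix.mul_diagonal, Matrix.diagonal_mul]
    simp only [toricDiff, Finset.sum_mul, Finset.mul_sum]
    refine Finset.sum_congr rfl fun i _ => ?_
    split_ifs with hi
    · subst hi
      rw [Fin.prod_univ_succAbove _ i]
      simp only [OrderedSimplex.vertex_delete]
      ring
    · simp

/-- Over a field, the complex depends only on the support of the weights. -/
theorem NullHomotopic.of_support_eq {K : Type*} [Field K] {x y : V → K} {q : ℕ} {d : K}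
    (hxy : ∀ v, x v = 0 ↔ y v = 0)
    (h : NullHomotopic (toricDiff L x) q d) : NullHomotopic (toricDiff L y) q d := by
  classical
  -- The unit is `y v / x v` on the common support, and an arbitrary unit elsewhere.
  have := h.rescale (fun v => if hv : x v = 0 then 1 else
    Units.mk0 (y v / x v) (div_ne_zero (fun h0 => hv ((hxy v).2 h0)) hv))
  convert this using 2
  ext v
  split_ifs with hv
  · simp [hv, (hxy v).1 hv]
  · simp [div_mul_cancel₀ _ hv]

end ToricMatrix

/-! ### The Aomoto complex of the exterior Stanley–Reisner ring -/

section AomotoComplex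

variable (k : Type w) [Field k] {V : Type u} [Fintype V] [LinearOrder V]
variable (L : AbstractSimplicialComplex V)

/-- The cochains of all degrees. -/
abbrev Cochains : Type _ := ∀ n, OrderedSimplex L n → k

/-- The left action of a degree one class on cochains. -/
def degreeOneAction : (V →₀ k) →ₗ[k] Module.End k (Cochains k L) :=
  LinearMap.mk₂ k (fun x c n => match n with
    | 0 => 0
    | n + 1 => c n ᵥ* toricDiff L x n)
    (fun x y c => by
      ext n t; cases n
      · simp
      · simp only [Finsupp.coe_add, toricDiff_add, Matrix.vecMul_add]; rfl)
    (fun a x c => by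
      ext n t; cases n
      · simp
      · simp only [Finsupp.coe_smul, toricDiff_smul, Matrix.vecMul_smul]; rfl)
    (fun x c d => by
      ext n t; cases n
      · simp
      · simp only [Pi.add_apply, Matrix.add_vecMul])
    (fun a x c => by
      ext n t; cases n
      · simp
      · simp only [Pi.smul_apply, Matrix.smul_vecMul])

theorem degreeOneAction_zero (x : V →₀ k) (c : Cochains k L) : degreeOneAction k L x c 0 = 0 := rfl

theorem degreeOneAction_succ (x : V →₀ k) (c : Cochains k L) (n : ℕ) :
    degreeOneAction k L x c (n + 1) = c n ᵥ* toricDiff L x n := rfl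

theorem degreeOneAction_sq (x : V →₀ k) : degreeOneAction k L x * degreeOneAction k L x = 0 := by
  ext c n t
  rw [Module.End.mul_apply]
  cases n with
  | zero => rfl
  | succ n =>
    rw [degreeOneAction_succ]
    cases n with
    | zero => simp [degreeOneAction_zero]
    | succ n => simp [degreeOneAction_succ, Matrix.vecMul_vecMul, toricDiff_mul_toricDiff]

/-- The action of the exterior algebra on cochains. -/
def exteriorAction : ExteriorAlgebra k (V →₀ k) →ₐ[k] Module.End k (Cochains k L) :=
  ExteriorAlgebra.lift k ⟨degreeOneAction k L, degreeOneAction_sq k L⟩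

theorem exteriorAction_ι (x : V →₀ k) :
    exteriorAction k L (ExteriorAlgebra.ι k x) = degreeOneAction k L x :=
  ExteriorAlgebra.lift_ι_apply _ _ _ _

theorem degreeOneAction_single_succ (v : V) (c : Cochains k L) (n : ℕ)
    (t : OrderedSimplex L (n + 1)) :
    degreeOneAction k L (Finsupp.single v 1) c (n + 1) t =
      ∑ i : Fin (n + 1), if t.vertex i = v then (-1) ^ (i : ℕ) * c n (t.delete i) else 0 := by
  rw [degreeOneAction_succ, vecMul_toricDiff]
  refine Finset.sum_congr rfl fun i _ => ?_
  by_cases h : t.vertex i = v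
  · simp [h]
  · simp [h, Finsupp.single_eq_of_ne h]

/-- Each factor `v^*` contributes only at simplices containing `v`. Hence the monomial of a missing
face acts by zero, and the action descends to the Stanley–Reisner ring. -/
theorem exteriorAction_prod_ne_zero (l : List V) (c : Cochains k L) (n : ℕ)
    (t : OrderedSimplex L n) (h : exteriorAction k L
      ((l.map fun v => ExteriorAlgebra.ι k (Finsupp.single v (1 : k))).prod) c n t ≠ 0) :
    ∀ v ∈ l, ∃ i, t.vertex i = v := by
  induction l generalizing n with
  | nil => simp
  | cons w l ih =>
    rw [List.map_cons, List.prod_cons, map_mul, exteriorAction_ι, Module.End.mul_apply] at h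
    cases n with
    | zero => exact absurd rfl h
    | succ n =>
      rw [degreeOneAction_single_succ] at h
      obtain ⟨i, -, hi⟩ := Finset.exists_ne_zero_of_sum_ne_zero h
      rw [ite_ne_right_iff] at hi
      have h1 := ih n (t.delete i) (right_ne_zero_of_mul hi.2)
      intro v hv
      rcases List.mem_cons.mp hv with rfl | hv
      · exact ⟨i, hi.1⟩
      · obtain ⟨j, hj⟩ := h1 v hv
        exact ⟨_, hj⟩

theorem exteriorAction_monomial_of_not_isSimplex {σ : Finset V} (hσ : ¬ IsSimplex L σ) :
    exteriorAction k L (monomial k σ) = 0 := by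
  ext c n t
  by_contra h
  refine hσ (t.2.mono fun v hv => ?_)
  obtain ⟨i, rfl⟩ := exteriorAction_prod_ne_zero k L _ c n t h v ((Finset.mem_sort _).2 hv)
  exact Finset.mem_map_of_mem _ (Finset.mem_univ i)

/-- The action of the exterior Stanley–Reisner ring on cochains. -/
def stanleyReisnerAction : ExteriorSR k L →ₐ[k] Module.End k (Cochains k L) :=
  RingQuot.liftAlgHom k ⟨exteriorAction k L, by
    rintro _ _ ⟨σ, hσ⟩
    rw [exteriorAction_monomial_of_not_isSimplex k L hσ, map_zero]⟩

theorem stanleyReisnerAction_mk (a : ExteriorAlgebra k (V →₀ k)) :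
    stanleyReisnerAction k L (RingQuot.mkAlgHom k (missingFaceRel k L) a) =
      exteriorAction k L a :=
  RingQuot.liftAlgHom_mkAlgHom_apply _ _ _ _

/-- The unit cochain. -/
def unitCochain : Cochains k L
  | 0 => 1
  | _ + 1 => 0

/-- The cochain of an element of the exterior Stanley–Reisner ring. -/
def toCochain : ExteriorSR k L →ₗ[k] Cochains k L :=
  (LinearMap.applyₗ (unitCochain k L)).comp (stanleyReisnerAction k L).toLinearMap

theorem toCochain_mk_ι_mul (x : V →₀ k) (a : ExteriorSR k L) (n : ℕ) :
    toCochain k L (RingQuot.mkAlgHom k (missingFaceRel k L) (ExteriorAlgebra.ι k x) * a) (n + 1) =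
      toCochain k L a n ᵥ* toricDiff L x n := by
  simp only [toCochain, LinearMap.comp_apply, AlgHom.toLinearMap_apply, map_mul,
    stanleyReisnerAction_mk, exteriorAction_ι]
  rfl

variable {L} in
/-- The class of the monomial of a simplex. -/
def simplexMonomial {n : ℕ} (s : OrderedSimplex L n) : ExteriorSR k L :=
  RingQuot.mkAlgHom k (missingFaceRel k L)
    (ExteriorAlgebra.ιMulti k n fun i => Finsupp.single (s.vertex i) 1)

variable {L} in
-- Vertices are listed in increasing order, so the position of the least vertex is forced to be `0`.
theorem OrderedSimplex.eq_of_delete_eq {n : ℕ} {s t : OrderedSimplex L (n + 1)} {i : Fin (n + 1)}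
    (hi : t.vertex i = s.vertex 0) (h : t.delete i = s.delete 0) : i = 0 ∧ t = s := by
  have hi0 : i = 0 := by
    by_contra hne
    obtain ⟨j, hj⟩ := Fin.exists_succAbove_eq (Ne.symm hne)
    have h1 : t.vertex 0 = s.vertex j.succ := by
      rw [← hj, ← OrderedSimplex.vertex_delete, h, OrderedSimplex.vertex_delete,
        Fin.succAbove_zero]
    have h2 : s.vertex 0 < s.vertex j.succ := s.1.strictMono (Fin.succ_pos j)
    have h3 : t.vertex 0 ≤ t.vertex i := t.1.monotone (Fin.zero_le i)
    rw [h1, hi] at h3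
    exact absurd h2 (not_lt.2 h3)
  subst hi0
  refine ⟨rfl, OrderedSimplex.ext_vertex fun j => ?_⟩
  refine Fin.cases hi (fun j => ?_) j
  have := congrArg (fun r => r.vertex j) h
  simpa [OrderedSimplex.vertex_delete] using this

/-- Acting on the unit cochain separates the simplex monomials, so they are linearly independent in
the quotient. Together with `component_eq_span` they form a basis of each component. -/
theorem toCochain_simplexMonomial {n : ℕ} (s : OrderedSimplex L n) :
    toCochain k L (simplexMonomial k s) n = Pi.single s 1 := by
  induction n with
  | zero =>
    have : simplexMonomial k s = 1 := by simp [simplexMonomial]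
    ext t
    obtain rfl : t = s := OrderedSimplex.ext_vertex fun i => i.elim0
    simp [this, toCochain, unitCochain]
  | succ n ih =>
    have h : simplexMonomial k s = RingQuot.mkAlgHom k (missingFaceRel k L)
        (ExteriorAlgebra.ι k (Finsupp.single (s.vertex 0) 1)) *
        simplexMonomial k (s.delete 0) := by
      rw [simplexMonomial, ExteriorAlgebra.ιMulti_succ_apply, map_mul, simplexMonomial]
      rfl
    ext t
    rw [h, toCochain_mk_ι_mul, ih, vecMul_toricDiff]
    by_cases hts : t = s
    · subst hts
      rw [Finset.sum_eq_single 0]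
      · simp
      · intro i _ hi
        by_cases h1 : t.vertex i = t.vertex 0
        · exact absurd (t.1.injective h1) hi
        · simp [Finsupp.single_eq_of_ne h1]
      · simp
    · rw [Pi.single_eq_of_ne hts]
      refine Finset.sum_eq_zero fun i _ => ?_
      by_cases h1 : t.vertex i = s.vertex 0
      · by_cases h2 : t.delete i = s.delete 0
        · exact absurd (OrderedSimplex.eq_of_delete_eq h1 h2).2 hts
        · simp [Pi.single_eq_of_ne h2]
      · simp [Finsupp.single_eq_of_ne h1]

theorem sort_univ_map {n : ℕ} (s : Fin n ↪o V) :
    (Finset.univ.map s.toEmbedding).sort (· ≤ ·) = List.ofFn s := by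
  refine List.Perm.eq_of_pairwise' (r := (· ≤ ·)) (Finset.pairwise_sort _ _) ?_ ?_
  · exact List.pairwise_ofFn.2 fun i j hij => s.monotone hij.le
  · refine (List.perm_ext_iff_of_nodup (Finset.sort_nodup _ _)
      (List.nodup_ofFn.2 s.injective)).2 fun v => ?_
    simp [List.mem_ofFn]

theorem monomial_univ_map {n : ℕ} (s : Fin n ↪o V) :
    monomial k (Finset.univ.map s.toEmbedding) =
      ExteriorAlgebra.ιMulti k n fun i => Finsupp.single (s i) 1 := by
  rw [monomial, sort_univ_map, ExteriorAlgebra.ιMulti_apply, List.map_ofFn]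
  rfl

theorem component_eq_span (n : ℕ) : ExteriorSR.component k L n =
    Submodule.span k (Set.range fun s : OrderedSimplex L n => simplexMonomial k s) := by
  have hspan : Submodule.span k (Set.range fun v : V => (Finsupp.single v 1 : V →₀ k)) = ⊤ := by
    rw [← Finsupp.coe_basisSingleOne, Module.Basis.span_eq]
  rw [ExteriorSR.component, ← exteriorPower.ιMulti_family_span_fixedDegree_of_span k hspan,
    Submodule.map_span, ← Set.range_comp]
  apply le_antisymm
  · rw [Submodule.span_le]
    rintro _ ⟨σ, rfl⟩
    set s : Fin n ↪o V := Set.powersetCard.ofFinEmbEquiv.symm σ with hs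
    have h1 : ExteriorAlgebra.ιMulti_family k n (fun v : V => (Finsupp.single v 1 : V →₀ k)) σ =
      ExteriorAlgebra.ιMulti k n fun i => Finsupp.single (s i) 1 := rfl
    rw [Function.comp_apply, h1]
    by_cases h : IsSimplex L (Finset.univ.map s.toEmbedding)
    · exact Submodule.subset_span ⟨⟨s, h⟩, rfl⟩
    · rw [← monomial_univ_map, AlgHom.toLinearMap_apply,
        RingQuot.mkAlgHom_rel k (missingFaceRel.missing _ h), map_zero]
      exact Submodule.zero_mem _
  · refine Submodule.span_mono ?_
    rintro _ ⟨s, rfl⟩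
    refine ⟨Set.powersetCard.ofFinEmbEquiv s.1, ?_⟩
    simp only [Function.comp_apply, ExteriorAlgebra.ιMulti_family, Equiv.symm_apply_apply]
    rfl

/-- The element of the exterior Stanley–Reisner ring with given coefficients in degree `n`. -/
def ofCochain (n : ℕ) : (OrderedSimplex L n → k) →ₗ[k] ExteriorSR k L :=
  Fintype.linearCombination k fun s => simplexMonomial k s

theorem range_ofCochain (n : ℕ) :
    LinearMap.range (ofCochain k L n) = ExteriorSR.component k L n := by
  rw [component_eq_span, ofCochain, Fintype.range_linearCombination]

theorem toCochain_ofCochain {n : ℕ} (c : OrderedSimplex L n → k) :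
    toCochain k L (ofCochain k L n c) n = c := by
  rw [ofCochain, Fintype.linearCombination_apply, map_sum]
  ext t
  simp [Finset.sum_apply, toCochain_simplexMonomial, Pi.single_apply]

theorem ι_mul_mem_component (x : V →₀ k) {n : ℕ} {a : ExteriorSR k L}
    (ha : a ∈ ExteriorSR.component k L n) :
    RingQuot.mkAlgHom k (missingFaceRel k L) (ExteriorAlgebra.ι k x) * a ∈
      ExteriorSR.component k L (n + 1) := by
  obtain ⟨b, hb, rfl⟩ := ha
  refine ⟨ExteriorAlgebra.ι k x * b, ?_, map_mul (RingQuot.mkAlgHom k _) _ _⟩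
  change _ ∈ LinearMap.range (ExteriorAlgebra.ι k) ^ (n + 1)
  rw [pow_succ']
  exact Submodule.mul_mem_mul ⟨x, rfl⟩ hb

theorem ι_mul_ofCochain (x : V →₀ k) {n : ℕ} (c : OrderedSimplex L n → k) :
    RingQuot.mkAlgHom k (missingFaceRel k L) (ExteriorAlgebra.ι k x) * ofCochain k L n c =
      ofCochain k L (n + 1) (c ᵥ* toricDiff L x n) := by
  -- The product lies in the span of the degree `n + 1` monomials, so it is determined by its
  -- cochain.
  have h := ι_mul_mem_component k L x
    ((range_ofCochain k L n).le (LinearMap.mem_range_self _ c))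
  rw [← range_ofCochain] at h
  obtain ⟨d, hd⟩ := h
  have h2 := congrArg (fun a => toCochain k L a (n + 1)) hd
  simp only [toCochain_ofCochain, toCochain_mk_ι_mul] at h2
  rw [← hd, h2]

/-- The Aomoto complex uses right multiplication and the toric differential left multiplication;
graded commutativity reduces the difference to a sign. -/
theorem mul_ι_eq_of_mem_exteriorPower {M : Type*} [AddCommGroup M] [Module k M] (m : M) {n : ℕ}
    {a : ExteriorAlgebra k M} (ha : a ∈ ⋀[k]^n M) :
    a * ExteriorAlgebra.ι k m = (-1 : k) ^ n • (ExteriorAlgebra.ι k m * a) := by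
  induction ha using Submodule.pow_induction_on_left' with
  | algebraMap r => simp [Algebra.commutes]
  | add x y i hx hy h1 h2 => rw [add_mul, h1, h2, mul_add, smul_add]
  | mem_mul y hy i x hx h =>
    obtain ⟨y, rfl⟩ := hy
    rw [mul_assoc, h, mul_smul_comm, ← mul_assoc, ← mul_assoc,
      eq_neg_of_add_eq_zero_left (ExteriorAlgebra.ι_add_mul_swap y m), neg_mul, pow_succ,
      mul_neg_one, neg_smul, smul_neg]

theorem mul_ι_eq_of_mem_component (x : V →₀ k) {n : ℕ} {a : ExteriorSR k L}
    (ha : a ∈ ExteriorSR.component k L n) :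
    a * RingQuot.mkAlgHom k (missingFaceRel k L) (ExteriorAlgebra.ι k x) =
      (-1 : k) ^ n • (RingQuot.mkAlgHom k (missingFaceRel k L) (ExteriorAlgebra.ι k x) * a) := by
  obtain ⟨b, hb, rfl⟩ := ha
  rw [AlgHom.toLinearMap_apply, ← map_mul, mul_ι_eq_of_mem_exteriorPower k x hb, map_smul, map_mul]

theorem zW_eq (W : Finset V) : ExteriorSR.zW k L W =
    RingQuot.mkAlgHom k (missingFaceRel k L)
      (ExteriorAlgebra.ι k (∑ v ∈ W, Finsupp.single v 1)) := by
  simp [ExteriorSR.zW]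

theorem coe_sum_single (W : Finset V) :
    ⇑(∑ v ∈ W, Finsupp.single v 1 : V →₀ k) = fun v => if v ∈ W then (1 : k) else 0 := by
  ext v
  simp [Finsupp.finsetSum_apply, Finsupp.single_apply]

instance finite_component (n : ℕ) : Module.Finite k (ExteriorSR.component k L n) := by
  rw [← range_ofCochain]
  infer_instance

theorem aomotoBetti_eq_zero_iff (a : ExteriorSR k L) (n : ℕ) :
    aomotoBetti (ExteriorSR.component k L) a n = 0 ↔
      ∀ b ∈ ExteriorSR.component k L n, b * a = 0 →
        b ∈ aomotoCoboundaries (ExteriorSR.component k L) a n := by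
  -- Finite dimension is needed because `finrank` is also `0` on infinite-dimensional spaces.
  have : Module.Finite k (aomotoCocycles (ExteriorSR.component k L) a n) :=
    Submodule.finiteDimensional_of_le (S₂ := ExteriorSR.component k L n) inf_le_left
  rw [aomotoBetti, Module.finrank_zero_iff, Submodule.Quotient.subsingleton_iff,
    Submodule.submoduleOf, Submodule.comap_subtype_eq_top]
  exact ⟨fun h b hb hba => h ⟨hb, hba⟩, fun h b hb => h b hb.1 hb.2⟩

theorem forall_aomotoBetti_eq_zero_iff (W : Finset V) (q : ℕ) :
    (∀ i ≤ q, aomotoBetti (ExteriorSR.component k L) (ExteriorSR.zW k L W) i = 0) ↔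
      DualExact (toricDiff L fun v => if v ∈ W then (1 : k) else 0) q := by
  simp only [aomotoBetti_eq_zero_iff, zW_eq, ← coe_sum_single]
  set x : V →₀ k := ∑ v ∈ W, Finsupp.single v 1
  set z := RingQuot.mkAlgHom k (missingFaceRel k L) (ExteriorAlgebra.ι k x)
  have hinj : ∀ n (c : OrderedSimplex L n → k), ofCochain k L n c = 0 → c = 0 := fun n c hc => by
    rw [← toCochain_ofCochain k L c, hc, map_zero]; rfl
  have hmem : ∀ n (c : OrderedSimplex L n → k), ofCochain k L n c ∈ ExteriorSR.component k L n :=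
    fun n c => (range_ofCochain k L n).le (LinearMap.mem_range_self _ c)
  have hmul : ∀ n (c : OrderedSimplex L n → k), ofCochain k L n c * z =
      (-1 : k) ^ n • ofCochain k L (n + 1) (c ᵥ* toricDiff L x n) := fun n c => by
    rw [mul_ι_eq_of_mem_component k L x (hmem n c), ι_mul_ofCochain]
  have hu : ∀ n, (-1 : k) ^ n ≠ 0 := fun n => pow_ne_zero _ (neg_ne_zero.2 one_ne_zero)
  have hcoc : ∀ n (c : OrderedSimplex L n → k), ofCochain k L n c * z = 0 ↔
      c ᵥ* toricDiff L x n = 0 := fun n c => by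
    rw [hmul, smul_eq_zero_iff_right (hu n)]
    exact ⟨hinj _ _, fun h => by rw [h, map_zero]⟩
  have hall : ∀ n (P : ExteriorSR k L → Prop), (∀ b ∈ ExteriorSR.component k L n, P b) ↔
      ∀ c, P (ofCochain k L n c) := fun n P => by
    rw [← range_ofCochain]
    exact ⟨fun h c => h _ ⟨c, rfl⟩, by rintro h _ ⟨c, rfl⟩; exact h c⟩
  simp only [hall, hcoc]
  have hcob : ∀ n (c : OrderedSimplex L (n + 1) → k), ofCochain k L (n + 1) c ∈
      aomotoCoboundaries (ExteriorSR.component k L) z (n + 1) ↔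
      ∃ b, c = b ᵥ* toricDiff L x n := fun n c => by
    rw [aomotoCoboundaries, ← range_ofCochain]
    constructor
    · rintro ⟨_, ⟨b, rfl⟩, hb⟩
      refine ⟨(-1 : k) ^ n • b, ?_⟩
      rw [LinearMap.mulRight_apply, hmul, ← map_smul, ← sub_eq_zero, ← map_sub] at hb
      rw [Matrix.smul_vecMul]
      exact (sub_eq_zero.1 (hinj _ _ hb)).symm
    · rintro ⟨b, rfl⟩
      refine ⟨ofCochain k L n ((-1 : k) ^ n • b), ⟨_, rfl⟩, ?_⟩
      rw [LinearMap.mulRight_apply, hmul, Matrix.smul_vecMul, map_smul, smul_smul, ← mul_pow]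
      simp
  constructor
  · intro h
    exact ⟨fun c hc => hinj 0 c (h 0 (Nat.zero_le q) c hc),
      fun n hn c hc => (hcob n c).1 (h (n + 1) hn c hc)⟩
  · rintro ⟨h0, h1⟩ n hn c hc
    cases n with
    | zero =>
      rw [h0 c hc, map_zero]
      exact Submodule.zero_mem _
    | succ n => exact (hcob n c).2 (h1 n hn c hc)

end AomotoComplex

/-! ### Homology of the cover as a module over the group algebra -/

namespace PrecubicalComplex

open CategoryTheory

variable (X : PrecubicalComplex.{u}) (k : Type w) [Field k]

/-- The cellular cycles. -/
def cycles : ∀ n, Submodule k (X.cells n →₀ k)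
  | 0 => ⊤
  | n + 1 => LinearMap.ker (X.boundary k n)

theorem chainComplex_d (n : ℕ) :
    (X.chainComplex k).d (n + 1) n = ModuleCat.ofHom (X.boundary k n) :=
  ChainComplex.of_d (fun n => ModuleCat.of k (X.cells n →₀ k))
    (fun n => ModuleCat.ofHom (X.boundary k n)) n

theorem ker_chainComplex_d_next (n : ℕ) : ∃ m, (ComplexShape.down ℕ).next n = m ∧
    LinearMap.ker ((X.chainComplex k).d n m).hom = X.cycles k n := by
  cases n with
  | zero =>
    refine ⟨_, rfl, ?_⟩
    -- There is no differential out of degree `0`: the index given by `next` is a default value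
    -- unrelated to `0`, so the map is zero and every chain is a cycle.
    rw [(X.chainComplex k).shape _ _ (by simp)]
    exact LinearMap.ker_zero
  | succ n =>
    refine ⟨n, ChainComplex.next_nat_succ n, ?_⟩
    rw [chainComplex_d]
    rfl

theorem finite_homology_iff (n : ℕ) {N : Type*} [AddCommGroup N] [Module k N]
    (F : X.cycles k n →ₗ[k] N) (hF : Function.Surjective F)
    (hker : ∀ z, F z = 0 ↔ (z : X.cells n →₀ k) ∈ LinearMap.range (X.boundary k n)) :
    Module.Finite k (X.homology k n) ↔ Module.Finite k N := by
  obtain ⟨m, hm, hg⟩ := X.ker_chainComplex_d_next k n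
  let S := (X.chainComplex k).sc' (n + 1) n m
  let e : X.homology k n ≅ S.moduleCatLeftHomologyData.H :=
    (X.chainComplex k).homologyIsoSc' _ _ _ (ChainComplex.prev ℕ n) hm ≪≫ S.moduleCatHomologyIso
  have hf : S.f.hom = X.boundary k n := congrArg ModuleCat.Hom.hom (X.chainComplex_d k n)
  have hmem : ∀ z : X.cells n →₀ k, z ∈ LinearMap.ker S.g.hom → z ∈ X.cycles k n :=
    fun z hz => hg.le hz
  let G : LinearMap.ker S.g.hom →ₗ[k] N :=
    { toFun := fun z => F ⟨z.1, hmem z.1 z.2⟩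
      map_add' := fun x y => F.map_add ⟨x.1, hmem x.1 x.2⟩ ⟨y.1, hmem y.1 y.2⟩
      map_smul' := fun a x => F.map_smul a ⟨x.1, hmem x.1 x.2⟩ }
  have hG : Function.Surjective G := fun y => by
    obtain ⟨z, rfl⟩ := hF y
    exact ⟨⟨z.1, hg.ge z.2⟩, rfl⟩
  have hGker : LinearMap.range S.moduleCatToCycles = LinearMap.ker G := by
    ext z
    rw [LinearMap.mem_ker]
    refine Iff.trans ?_ (hker ⟨z.1, hmem z.1 z.2⟩).symm
    rw [← hf]
    constructor
    · rintro ⟨y, rfl⟩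
      exact ⟨y, rfl⟩
    · rintro ⟨y, hy⟩
      exact ⟨y, Subtype.ext hy⟩
  let e' : S.moduleCatLeftHomologyData.H ≃ₗ[k] N :=
    (Submodule.quotEquivOfEq _ _ hGker).trans (G.quotKerEquivOfSurjective hG)
  exact Module.Finite.equiv_iff (e.toLinearEquiv.trans e')

end PrecubicalComplex

section Cover

variable {V : Type u} [Fintype V] [LinearOrder V] {L : AbstractSimplicialComplex V}
variable {H : Type v} [CommGroup H] (ν : ToricGroup L →* H) (k : Type w) [Field k]

/-- The weight `ν(v) - 1` of a vertex in the group algebra. -/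
def coverWeight (v : V) : MonoidAlgebra k H := MonoidAlgebra.of k H (ν (gen v)) - 1

/-- The cellular chains of the cover form a free module over the group algebra. -/
def chainEquiv (n : ℕ) : ((toricCover ν).cells n →₀ k) ≃ₗ[k]
    (OrderedSimplex L n → MonoidAlgebra k H) :=
  (Finsupp.domLCongr (Equiv.prodComm H (OrderedSimplex L n))).trans <|
    (Finsupp.curryLinearEquiv k).trans <|
    (Finsupp.linearEquivFunOnFinite k _ _).trans <|
    LinearEquiv.piCongrRight fun _ => (MonoidAlgebra.coeffLinearEquiv k).symm

theorem chainEquiv_single (n : ℕ) (h : H) (s : OrderedSimplex L n) (a : k) :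
    chainEquiv ν k n (Finsupp.single ((h, s) : H × OrderedSimplex L n) a) =
      Pi.single s (MonoidAlgebra.single h a) := by
  have h1 : (Finsupp.domLCongr (M := k) (R := k) (Equiv.prodComm H (OrderedSimplex L n)))
      (Finsupp.single ((h, s) : H × OrderedSimplex L n) a) =
      Finsupp.single ((s, h) : OrderedSimplex L n × H) a :=
    Finsupp.domLCongr_single (R := k) _ _ _
  ext t : 1
  change MonoidAlgebra.ofCoeff ((Finsupp.domLCongr (M := k) (R := k)
    (Equiv.prodComm H (OrderedSimplex L n)) (Finsupp.single (h, s) a)).curry t) = _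
  rw [h1, Finsupp.curry_single]
  by_cases hts : t = s
  · subst hts
    rw [Finsupp.single_eq_same, Pi.single_eq_same]
    rfl
  · rw [Finsupp.single_eq_of_ne hts, Pi.single_eq_of_ne hts]
    rfl

/-- The two faces in the direction of `v` differ by translation by `ν(v)`, so their difference is
multiplication by `ν(v) - 1`. Commutativity of `H` lets right translation act as a scalar. -/
theorem chainEquiv_boundary (n : ℕ) (c : (toricCover ν).cells (n + 1) →₀ k) :
    chainEquiv ν k n ((toricCover ν).boundary k n c) =
      toricDiff L (coverWeight ν k) n *ᵥ chainEquiv ν k (n + 1) c := by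
  induction c using Finsupp.induction_linear with
  | zero => simp
  | add c d hc hd => simp only [map_add, hc, hd, Matrix.mulVec_add]
  | single c a =>
    simp only [PrecubicalComplex.boundary, LinearMap.sum_apply, LinearMap.smul_apply, map_sum,
      map_smul, PrecubicalComplex.faceDiff_single, map_sub]
    obtain ⟨h, t⟩ := c
    rw [chainEquiv_single, Matrix.mulVec_single]
    ext1 s
    rw [Finset.sum_apply]
    simp only [Pi.smul_apply, Matrix.col_apply, toricDiff, MulOpposite.smul_eq_mul_unop,
      MulOpposite.unop_op, Finset.sum_mul]
    refine Finset.sum_congr rfl fun i _ => ?_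
    have h1 : chainEquiv ν k n (Finsupp.single ((toricCover ν).upper i (h, t)) a) =
        Pi.single (t.delete i) (MonoidAlgebra.single (h * ν (gen (t.vertex i))) a) :=
      chainEquiv_single ν k n _ _ a
    have h2 : chainEquiv ν k n (Finsupp.single ((toricCover ν).lower i (h, t)) a) =
        Pi.single (t.delete i) (MonoidAlgebra.single h a) :=
      chainEquiv_single ν k n _ _ a
    rw [h1, h2]
    split_ifs with hs
    · subst hs
      rw [Pi.sub_apply, Pi.single_eq_same, Pi.single_eq_same, mul_assoc, coverWeight, sub_mul,
        one_mul, MonoidAlgebra.of_apply, MonoidAlgebra.single_mul_single, one_mul, mul_comm h,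
        Algebra.smul_def, map_pow, map_neg, map_one]
    · simp [Pi.single_eq_of_ne (Ne.symm hs)]

end Cover

/-! ### Homology as a module over the ring of coefficients -/

section CycleModule

variable {S : ℕ → Type u} [∀ n, Fintype (S n)] {A : Type v} [CommRing A]

/-- The module of cycles. -/
def cycleModule (D : ∀ n, Matrix (S n) (S (n + 1)) A) (n : ℕ) : Submodule A (S n → A) where
  carrier := {z | IsCycle D n z}
  zero_mem' := by cases n <;> simp [IsCycle]
  add_mem' := by
    cases n
    · simp [IsCycle]
    · intro a b ha hb
      simp_all [IsCycle, Matrix.mulVec_add]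
  smul_mem' := by
    cases n
    · simp [IsCycle]
    · intro a b hb
      simp_all [IsCycle, Matrix.mulVec_smul]

/-- The homology of the complex with differentials `D`. -/
abbrev MatrixHomology (D : ∀ n, Matrix (S n) (S (n + 1)) A) (n : ℕ) : Type _ :=
  cycleModule D n ⧸ (LinearMap.range (D n).mulVecLin).submoduleOf (cycleModule D n)

theorem killsHomology_iff {D : ∀ n, Matrix (S n) (S (n + 1)) A} {q : ℕ} {d : A} :
    KillsHomology D q d ↔ ∀ n ≤ q, ∀ z : MatrixHomology D n, d • z = 0 := by
  refine forall₂_congr fun n _ => ?_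
  constructor
  · intro h z
    obtain ⟨z, rfl⟩ := Submodule.Quotient.mk_surjective _ z
    rw [← Submodule.Quotient.mk_smul, Submodule.Quotient.mk_eq_zero]
    exact h z.1 z.2
  · intro h z hz
    have := h (Submodule.Quotient.mk ⟨z, hz⟩)
    rw [← Submodule.Quotient.mk_smul, Submodule.Quotient.mk_eq_zero] at this
    exact this

end CycleModule

section Cover

variable {V : Type u} [Fintype V] [LinearOrder V] {L : AbstractSimplicialComplex V}
variable {H : Type v} [CommGroup H] (ν : ToricGroup L →* H) (k : Type w) [Field k]

theorem chainEquiv_mem_cycleModule_iff (n : ℕ) (z : (toricCover ν).cells n →₀ k) :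
    chainEquiv ν k n z ∈ cycleModule (toricDiff L (coverWeight ν k)) n ↔
      z ∈ (toricCover ν).cycles k n := by
  cases n with
  | zero => exact iff_of_true trivial trivial
  | succ n =>
    change toricDiff L (coverWeight ν k) n *ᵥ _ = 0 ↔ (toricCover ν).boundary k n z = 0
    rw [← chainEquiv_boundary, map_eq_zero_iff _ (chainEquiv ν k n).injective]

/-- The homology class over the group algebra of a cellular cycle of the cover. -/
def cycleClass (n : ℕ) : (toricCover ν).cycles k n →ₗ[k]
    MatrixHomology (toricDiff L (coverWeight ν k)) n where
  toFun z := Submodule.Quotient.mk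
    ⟨chainEquiv ν k n z, (chainEquiv_mem_cycleModule_iff ν k n _).2 z.2⟩
  map_add' x y := by
    rw [← Submodule.Quotient.mk_add]
    exact congrArg _ (Subtype.ext (map_add (chainEquiv ν k n) x.1 y.1))
  map_smul' a x := by
    rw [RingHom.id_apply, ← Submodule.Quotient.mk_smul]
    exact congrArg _ (Subtype.ext (map_smul (chainEquiv ν k n) a x.1))

theorem finite_homology_toricCover_iff (n : ℕ) : Module.Finite k ((toricCover ν).homology k n) ↔
    Module.Finite k (MatrixHomology (toricDiff L (coverWeight ν k)) n) := by
  refine PrecubicalComplex.finite_homology_iff _ k n (cycleClass ν k n) ?_ ?_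
  · intro y
    obtain ⟨⟨y, hy⟩, rfl⟩ := Submodule.Quotient.mk_surjective _ y
    obtain ⟨z, rfl⟩ := (chainEquiv ν k n).surjective y
    exact ⟨⟨z, (chainEquiv_mem_cycleModule_iff ν k n _).1 hy⟩, rfl⟩
  · intro z
    refine (Submodule.Quotient.mk_eq_zero _).trans ?_
    constructor
    · rintro ⟨y, hy⟩
      obtain ⟨c, rfl⟩ := (chainEquiv ν k (n + 1)).surjective y
      refine ⟨c, (chainEquiv ν k n).injective ?_⟩
      rw [chainEquiv_boundary]
      exact hy
    · rintro ⟨c, hc⟩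
      refine ⟨chainEquiv ν k (n + 1) c, ?_⟩
      rw [Matrix.mulVecLin_apply, ← chainEquiv_boundary, hc]
      rfl

end Cover

/-! ### Finiteness of the homology of the cover -/

open Polynomial

/-- The element `g` acts as an endomorphism of a finite-dimensional space, hence is annihilated by a
monic polynomial. -/
theorem exists_monic_aeval_smul_eq_zero (k : Type*) [Field k] {A : Type*} [CommRing A]
    [Algebra k A] (M : Type*) [AddCommGroup M] [Module k M] [Module A M] [IsScalarTower k A M]
    [Module.Finite k M] (g : A) : ∃ p : k[X], p.Monic ∧ ∀ z : M, aeval g p • z = 0 := by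
  obtain ⟨p, hp, hp0⟩ := Algebra.IsIntegral.isIntegral (R := k) (Algebra.lsmul k k M g)
  refine ⟨p, hp, fun z => ?_⟩
  have h : aeval (Algebra.lsmul k k M g) p = 0 := hp0
  rw [aeval_algHom_apply] at h
  exact LinearMap.congr_fun h z

theorem exists_monic_killsHomology {k : Type*} [Field k] {A : Type*} [CommRing A] [Algebra k A]
    {S : ℕ → Type*} [∀ n, Fintype (S n)] (D : ∀ n, Matrix (S n) (S (n + 1)) A) (q : ℕ)
    (h : ∀ n ≤ q, Module.Finite k (MatrixHomology D n)) (g : A) :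
    ∃ p : k[X], p.Monic ∧ KillsHomology D q (aeval g p) := by
  have h1 : ∀ n, ∃ p : k[X], p.Monic ∧ (n ≤ q → ∀ z : MatrixHomology D n, aeval g p • z = 0) := by
    intro n
    by_cases hn : n ≤ q
    · have := h n hn
      obtain ⟨p, hp, hp0⟩ := exists_monic_aeval_smul_eq_zero k (MatrixHomology D n) g
      exact ⟨p, hp, fun _ => hp0⟩
    · exact ⟨1, monic_one, fun h => absurd h hn⟩
  choose p hp hp0 using h1
  refine ⟨∏ n ∈ Finset.range (q + 1), p n, monic_prod_of_monic _ _ fun n _ => hp n, ?_⟩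
  rw [killsHomology_iff]
  intro n hn z
  obtain ⟨b, hb⟩ := Finset.dvd_prod_of_mem p (Finset.mem_range.2 (Nat.lt_succ_of_le hn))
  rw [hb, map_mul, mul_comm, mul_smul, hp0 n hn, smul_zero]

/-- Distinct powers of `g` are distinct basis elements, so the leading coefficient survives. -/
theorem aeval_of_ne_zero (k : Type*) [Field k] {G : Type*} [CommGroup G] {g : G}
    (hg : Function.Injective fun n : ℕ => g ^ n) {p : k[X]} (hp : p.Monic) :
    aeval (MonoidAlgebra.of k G g) p ≠ 0 := by
  intro h
  have h1 := congrArg (fun x : MonoidAlgebra k G => x.coeff (g ^ p.natDegree)) h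
  simp only [aeval_eq_sum_range, MonoidAlgebra.of_apply] at h1
  rw [← MonoidAlgebra.coeffLinearEquiv_apply (R := k), map_sum, Finsupp.finsetSum_apply,
    Finset.sum_eq_single p.natDegree] at h1
  · simp [hp.coeff_natDegree] at h1
  · intro n _ hn
    have : g ^ n ≠ g ^ p.natDegree := fun h => hn (hg h)
    simp [this]
  · simp

/-! ### Passing between the group algebra and fields -/

section Cover

variable {V : Type u} [Fintype V] [LinearOrder V] {L : AbstractSimplicialComplex V}
variable {H : Type v} [CommGroup H] {ν : ToricGroup L →* H} {k : Type w} [Field k]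

/-- Mapping to `k[ℚ]` makes the weights vanish outside `W`, but some weights inside `W` may vanish
too. Deforming the latter over `k[ℚ][X]` gives support exactly `W`. -/
theorem nullHomotopic_of_killsHomology {q : ℕ} {g : H} {p : k[X]} (hp : p.Monic)
    (h : KillsHomology (toricDiff L (coverWeight ν k)) q (aeval (MonoidAlgebra.of k H g) p))
    (φ : H →* Multiplicative ℚ) (hφ : φ g ≠ 1) (W : Finset V)
    (hW : ∀ v ∉ W, φ (ν (gen v)) = 1) :
    NullHomotopic (toricDiff L fun v => if v ∈ W then (1 : k) else 0) q 1 := by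
  obtain ⟨N, h1⟩ := h.exists_nullHomotopic (toricDiff_mul_toricDiff _)
  let f : MonoidAlgebra k H →ₐ[k] MonoidAlgebra k (Multiplicative ℚ) :=
    MonoidAlgebra.mapDomainAlgHom k k φ
  have hf : ∀ g, f (MonoidAlgebra.of k H g) = MonoidAlgebra.of k _ (φ g) := fun g => by
    simp [f]
  have h2 := h1.map f.toRingHom
  have hd : f (aeval (MonoidAlgebra.of k H g) p ^ N) ≠ 0 := by
    rw [map_pow, ← aeval_algHom_apply, hf]
    refine pow_ne_zero _ (aeval_of_ne_zero k ?_ hp)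
    intro a b hab
    -- `ℚ` is torsion-free, so the powers of `φ g` are distinct.
    have h3 : (a : ℚ) * (φ g).toAdd = b * (φ g).toAdd := by
      simpa using congrArg Multiplicative.toAdd hab
    exact_mod_cast mul_right_cancel₀ (fun h => hφ h) h3
  -- At `X = 0` these weights specialise to the given ones, and for `v ∈ W` they are nonzero because
  -- the coefficient of `X` is `1`.
  let y : V → (MonoidAlgebra k (Multiplicative ℚ))[X] := fun v =>
    if v ∈ W then C (f (coverWeight ν k v)) + X else 0
  have hy : ∀ v, evalRingHom 0 (y v) = f (coverWeight ν k v) := fun v => by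
    by_cases hv : v ∈ W
    · simp [y, hv]
    · simp only [y, if_neg hv, map_zero, coverWeight, map_sub, map_one, hf, hW v hv, sub_self]
  have h3 : NullHomotopic (fun n => (toricDiff L y n).map
      (evalRingHom (0 : MonoidAlgebra k (Multiplicative ℚ)))) q
      (f (aeval (MonoidAlgebra.of k H g) p ^ N)) := by
    simp only [toricDiff_map, hy]
    simp only [toricDiff_map] at h2
    exact h2
  obtain ⟨c, N', hc, h4⟩ := h3.exists_killsHomology_of_surjective (toricDiff_mul_toricDiff _)
    (fun a => ⟨C a, by simp⟩)
  have hc0 : c ≠ 0 := by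
    rintro rfl
    exact pow_ne_zero N' hd (by rw [← hc, map_zero])
  obtain ⟨N'', h5⟩ := h4.exists_nullHomotopic (toricDiff_mul_toricDiff _)
  let F := FractionRing (MonoidAlgebra k (Multiplicative ℚ))[X]
  -- The nonzero scalar becomes invertible in the fraction field, so the identity itself is
  -- null-homotopic.
  have h6 := (h5.map (algebraMap _ F)).smul (algebraMap _ F (c ^ N''))⁻¹
  have hinj : Function.Injective (algebraMap (MonoidAlgebra k (Multiplicative ℚ))[X] F) :=
    IsFractionRing.injective _ F
  rw [inv_mul_cancel₀ (by rw [map_ne_zero_iff _ hinj]; exact pow_ne_zero _ hc0)] at h6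
  simp only [toricDiff_map] at h6
  have h7 : NullHomotopic (toricDiff L fun v => if v ∈ W then (1 : F) else 0) q 1 := by
    refine h6.of_support_eq fun v => ?_
    rw [map_eq_zero_iff _ hinj]
    by_cases hv : v ∈ W
    · simp only [y, if_pos hv, one_ne_zero, iff_false]
      rw [add_comm]
      exact X_add_C_ne_zero _
    · simp [y, hv]
  -- Indicator weights are defined over `k`, so a `k`-linear retraction `F → k` brings the
  -- contraction back.
  obtain ⟨ρ, hρ⟩ := (Algebra.linearMap k F).exists_leftInverse_of_injective
    (LinearMap.ker_eq_bot.2 (algebraMap k F).injective)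
  refine NullHomotopic.of_retraction (B := F) ρ ?_ ?_
  · simpa using LinearMap.congr_fun hρ 1
  · simpa only [toricDiff_map, apply_ite (algebraMap k F), map_one, map_zero] using h7

/-- Over the residue field of `m` the weights have support `W`, so the complex is contractible
there. Lifting the contraction gives a killing scalar congruent to `1` modulo `m`. -/
theorem exists_notMem_killsHomology (m : Ideal (MonoidAlgebra k H)) [hm : m.IsMaximal] {q : ℕ}
    (W : Finset V) (hW : ∀ v, v ∈ W ↔ coverWeight ν k v ∉ m)
    (h : NullHomotopic (toricDiff L fun v => if v ∈ W then (1 : k) else 0) q 1) :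
    ∃ c ∉ m, KillsHomology (toricDiff L (coverWeight ν k)) q c := by
  let _ := Ideal.Quotient.field m
  have h1 := h.map (algebraMap k (MonoidAlgebra k H ⧸ m))
  simp only [toricDiff_map, apply_ite (algebraMap k (MonoidAlgebra k H ⧸ m)), map_one,
    map_zero] at h1
  have h2 : NullHomotopic (toricDiff L fun v => Ideal.Quotient.mk m (coverWeight ν k v)) q 1 := by
    refine h1.of_support_eq fun v => ?_
    rw [Ideal.Quotient.eq_zero_iff_mem, ← not_iff_not, ← hW]
    simp
  have h3 : NullHomotopic (fun n => (toricDiff L (coverWeight ν k) n).map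
      (Ideal.Quotient.mk m)) q 1 := by
    simpa only [toricDiff_map] using h2
  obtain ⟨c, N, hc, h4⟩ := h3.exists_killsHomology_of_surjective (toricDiff_mul_toricDiff _)
    Ideal.Quotient.mk_surjective
  refine ⟨c, fun hcm => ?_, h4⟩
  rw [Ideal.Quotient.eq_zero_iff_mem.2 hcm, one_pow] at hc
  exact zero_ne_one hc

end Cover

/-- The ideal of the scalars that kill the homology in degrees `≤ q`. -/
def killingIdeal {S : ℕ → Type*} [∀ n, Fintype (S n)] {A : Type*} [CommRing A]
    (D : ∀ n, Matrix (S n) (S (n + 1)) A) (q : ℕ) : Ideal A where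
  carrier := {c | KillsHomology D q c}
  zero_mem' := killsHomology_iff.2 fun n _ z => zero_smul _ z
  add_mem' ha hb := killsHomology_iff.2 fun n hn z => by
    rw [add_smul, killsHomology_iff.1 ha n hn, killsHomology_iff.1 hb n hn, add_zero]
  smul_mem' c a ha := killsHomology_iff.2 fun n hn z => by
    rw [smul_assoc, killsHomology_iff.1 ha n hn, smul_zero]

/-- Each group element is a root of some `(X^n - 1)^N` in the quotient, so the quotient is an
integral algebra of finite type over `k`. -/
theorem finite_quotient_of_pow_sub_one_mem_radical {k : Type*} [Field k] {H : Type*} [CommGroup H]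
    [Group.FG H] (I : Ideal (MonoidAlgebra k H))
    (h : ∀ g : H, ∃ n > 0, MonoidAlgebra.of k H (g ^ n) - 1 ∈ I.radical) :
    Module.Finite k (MonoidAlgebra k H ⧸ I) := by
  have hint : ∀ g : H, IsIntegral k (Ideal.Quotient.mk I (MonoidAlgebra.of k H g)) := fun g => by
    obtain ⟨n, hn, N, hN⟩ := h g
    refine ⟨(X ^ n - C 1) ^ N, (monic_X_pow_sub_C 1 hn.ne').pow N, ?_⟩
    rw [← Ideal.Quotient.eq_zero_iff_mem] at hN
    rw [map_pow (Ideal.Quotient.mk I), map_sub, map_one, map_pow, map_pow] at hN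
    rw [eval₂_pow, eval₂_sub, eval₂_X_pow, eval₂_C, map_one]
    exact hN
  have : Algebra.IsIntegral k (MonoidAlgebra k H ⧸ I) := ⟨fun x => by
    obtain ⟨x, rfl⟩ := Ideal.Quotient.mk_surjective x
    induction x using MonoidAlgebra.induction_on with
    | of g => exact hint g
    | add x y hx hy => rw [map_add]; exact hx.add hy
    | smul a x hx =>
      have : Ideal.Quotient.mk I (a • x) = a • Ideal.Quotient.mk I x := rfl
      rw [this]
      exact hx.smul a⟩
  have : Algebra.FiniteType k (MonoidAlgebra k H) := inferInstance
  have : Algebra.FiniteType k (MonoidAlgebra k H ⧸ I) :=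
    Algebra.FiniteType.of_surjective (Ideal.Quotient.mkₐ k I) Ideal.Quotient.mk_surjective
  exact Algebra.IsIntegral.finite

theorem finite_of_finite_quotient {k : Type*} [Field k] {A : Type*} [CommRing A] [Algebra k A]
    (I : Ideal A) [Module.Finite k (A ⧸ I)] (M : Type*) [AddCommGroup M] [Module k M] [Module A M]
    [IsScalarTower k A M] [Module.Finite A M] (h : ∀ a ∈ I, ∀ z : M, a • z = 0) :
    Module.Finite k M := by
  have ht : Module.IsTorsionBySet A M (I : Set A) := fun z a => h a.1 a.2 z
  let _ := ht.module
  have : IsScalarTower A (A ⧸ I) M := ht.isScalarTower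
  have : IsScalarTower k (A ⧸ I) M := ht.isScalarTower
  have : Module.Finite (A ⧸ I) M := Module.Finite.of_restrictScalars_finite A _ _
  exact Module.Finite.trans (A ⧸ I) M

/-! ### The subspace condition in `ℤ^r` and the equivalence -/

section FreeAbelian

variable {V : Type u} [Fintype V] [LinearOrder V] {L : AbstractSimplicialComplex V}

/-- If `g` were outside the rational span of the `ν(v)` with `v ∉ W`, a linear functional separating
it would yield a nonzero class in the intersection. Membership in the span becomes membership of a
power after clearing denominators. -/
theorem exists_pow_mem_closure {r : ℕ} (ν : ToricGroup L →* Multiplicative (Fin r → ℤ))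
    (hν : Function.Surjective ν) (W : Finset V)
    (hW : LinearMap.range (H1.pullback ν) ⊓ coordSubspace L W = ⊥)
    (g : Multiplicative (Fin r → ℤ)) :
    ∃ n > 0, g ^ n ∈ Subgroup.closure {h | ∃ v ∉ W, h = ν (gen v)} := by
  let c : (Fin r → ℤ) →+ (Fin r → ℚ) := (Int.castAddHom ℚ).compLeft (Fin r)
  have hc : Function.Injective c := fun x y h => by
    ext i
    exact Int.cast_injective (congrFun h i)
  let K : Subgroup (Multiplicative (Fin r → ℤ)) := Subgroup.closure {h | ∃ v ∉ W, h = ν (gen v)}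
  let p : Submodule ℚ (Fin r → ℚ) := Submodule.span ℚ {x | ∃ v ∉ W, x = c (ν (gen v)).toAdd}
  have hgp : c g.toAdd ∈ p := by
    by_contra hgp
    obtain ⟨f, hf, hpf⟩ := Submodule.exists_le_ker_of_notMem hgp
    let φ : H1 (Multiplicative (Fin r → ℤ)) :=
      (f.toAddMonoidHom.comp c).comp (AddEquiv.refl (Fin r → ℤ)).toAddMonoidHom
    have h0 : H1.pullback ν φ = 0 := by
      rw [← Submodule.mem_bot (R := ℚ), ← hW]
      exact ⟨⟨φ, rfl⟩, fun v hv => hpf (Submodule.subset_span ⟨v, hv, rfl⟩)⟩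
    -- Surjectivity of `ν` turns the vanishing of the pullback into `f` vanishing at `g`, a
    -- contradiction.
    obtain ⟨x, rfl⟩ := hν g
    exact hf (DFunLike.congr_fun h0 (Additive.ofMul x))
  have hspan : ∀ x ∈ p, ∃ n : ℕ, 0 < n ∧ ∃ h ∈ K, (n : ℚ) • x = c h.toAdd := by
    intro x hx
    induction hx using Submodule.span_induction with
    | mem x hx =>
      obtain ⟨v, hv, rfl⟩ := hx
      exact ⟨1, one_pos, _, Subgroup.subset_closure ⟨v, hv, rfl⟩, by simp⟩
    | zero => exact ⟨1, one_pos, 1, K.one_mem, by simp⟩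
    | add x y _ _ hx hy =>
      obtain ⟨n, hn, h, hh, hx⟩ := hx
      obtain ⟨m, hm, h', hh', hy⟩ := hy
      refine ⟨n * m, Nat.mul_pos hn hm, h ^ m * h' ^ n,
        K.mul_mem (K.pow_mem hh m) (K.pow_mem hh' n), ?_⟩
      rw [toAdd_mul, toAdd_pow, toAdd_pow, map_add, map_nsmul, map_nsmul, ← hx, ← hy, smul_add,
        ← Nat.cast_smul_eq_nsmul ℚ, ← Nat.cast_smul_eq_nsmul ℚ, smul_smul, smul_smul, Nat.cast_mul,
        mul_comm (n : ℚ)]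
    | smul a x _ hx =>
      obtain ⟨n, hn, h, hh, hx⟩ := hx
      refine ⟨n * a.den, Nat.mul_pos hn a.den_pos, h ^ a.num, K.zpow_mem hh _, ?_⟩
      rw [toAdd_zpow, map_zsmul, ← hx, ← Int.cast_smul_eq_zsmul ℚ, smul_smul, smul_smul,
        ← Rat.mul_den_eq_num, Nat.cast_mul]
      congr 1
      ring
  obtain ⟨n, hn, h, hh, hx⟩ := hspan _ hgp
  refine ⟨n, hn, ?_⟩
  convert hh
  rw [Nat.cast_smul_eq_nsmul ℚ, ← map_nsmul] at hx
  exact Multiplicative.toAdd.injective (hc hx)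

theorem forall_finite_homology_iff {r : ℕ} (ν : ToricGroup L →* Multiplicative (Fin r → ℤ))
    (hν : Function.Surjective ν) (k : Type w) [Field k] (q : ℕ) :
    (∀ i ≤ q, Module.Finite k ((toricCover ν).homology k i)) ↔
      ∀ W : Finset V, (∃ i ≤ q,
        aomotoBetti (ExteriorSR.component k L) (ExteriorSR.zW k L W) i ≠ 0) →
        LinearMap.range (H1.pullback ν) ⊓ coordSubspace L W = ⊥ := by
  have hbetti : ∀ W : Finset V, (∃ i ≤ q,
      aomotoBetti (ExteriorSR.component k L) (ExteriorSR.zW k L W) i ≠ 0) ↔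
      ¬ NullHomotopic (toricDiff L fun v => if v ∈ W then (1 : k) else 0) q 1 := fun W => by
    have h : NullHomotopic (toricDiff L fun v => if v ∈ W then (1 : k) else 0) q 1 ↔ _ :=
      ⟨fun h => h.dualExact, fun h => h.nullHomotopic (toricDiff_mul_toricDiff _)⟩
    rw [h, ← forall_aomotoBetti_eq_zero_iff]
    push Not
    rfl
  simp only [hbetti, finite_homology_toricCover_iff]
  constructor
  · intro hfin W hW
    rw [eq_bot_iff]
    rintro _ ⟨⟨φ, rfl⟩, hφW⟩
    by_contra hne
    obtain ⟨g, hg⟩ : ∃ g, φ g ≠ 0 := by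
      by_contra! h
      exact hne (AddMonoidHom.ext fun x => h _)
    obtain ⟨p, hp, hkill⟩ := exists_monic_killsHomology _ q hfin
      (MonoidAlgebra.of k (Multiplicative (Fin r → ℤ)) g.toMul)
    exact hW (nullHomotopic_of_killsHomology hp hkill
      (AddMonoidHom.toMultiplicativeRight φ) hg W hφW)
  · intro hall
    classical
    let I := killingIdeal (toricDiff L (coverWeight ν k)) q
    -- An exponent is fixed for each of the finitely many `W`, with a dummy value `1` when the
    -- intersection is nonzero; the product over all `W` then serves every maximal ideal at once.
    have hpow : ∀ (g : Multiplicative (Fin r → ℤ)) (W : Finset V), ∃ n > 0,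
        LinearMap.range (H1.pullback ν) ⊓ coordSubspace L W = ⊥ →
        g ^ n ∈ Subgroup.closure {h | ∃ v ∉ W, h = ν (gen v)} := fun g W => by
      by_cases hW : LinearMap.range (H1.pullback ν) ⊓ coordSubspace L W = ⊥
      · obtain ⟨n, hn, h⟩ := exists_pow_mem_closure ν hν W hW g
        exact ⟨n, hn, fun _ => h⟩
      · exact ⟨1, one_pos, fun h => absurd h hW⟩
    choose N hN0 hN using hpow
    have hjac : IsJacobsonRing (MonoidAlgebra k (Multiplicative (Fin r → ℤ))) :=
      isJacobsonRing_of_finiteType (A := k)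
    have hnoeth : IsNoetherianRing (MonoidAlgebra k (Multiplicative (Fin r → ℤ))) :=
      Algebra.FiniteType.isNoetherianRing k _
    have hfin : Module.Finite k (MonoidAlgebra k (Multiplicative (Fin r → ℤ)) ⧸ I) := by
      refine finite_quotient_of_pow_sub_one_mem_radical I fun g =>
        ⟨∏ W, N g W, Finset.prod_pos fun W _ => hN0 g W, ?_⟩
      -- In a Jacobson ring the radical of `I` is the intersection of the maximal ideals containing
      -- it.
      rw [Ideal.radical_eq_jacobson, Ideal.jacobson, Ideal.mem_sInf]
      rintro m ⟨hIm, hm⟩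
      let W : Finset V := Finset.univ.filter fun v => coverWeight ν k v ∉ m
      have hWm : ∀ v, v ∈ W ↔ coverWeight ν k v ∉ m := fun v => by simp [W]
      -- If the indicator complex of `W` were contractible through degree `q`, some `c ∉ m` would
      -- lie in `I ⊆ m`.
      have hbot := hall W fun hnull => by
        obtain ⟨c, hcm, hc⟩ := exists_notMem_killsHomology m W hWm hnull
        exact hcm (hIm hc)
      let K : Subgroup (Multiplicative (Fin r → ℤ)) :=
        ((Ideal.Quotient.mk m).toMonoidHom.comp (MonoidAlgebra.of k _)).ker
      have hK : ∀ h, h ∈ K ↔ MonoidAlgebra.of k _ h - 1 ∈ m := fun h => by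
        rw [← Ideal.Quotient.eq_zero_iff_mem, map_sub, map_one, sub_eq_zero]
        rfl
      rw [← hK]
      have hle : Subgroup.closure {h | ∃ v ∉ W, h = ν (gen v)} ≤ K := by
        rw [Subgroup.closure_le]
        rintro _ ⟨v, hv, rfl⟩
        rw [hWm, not_not] at hv
        exact (hK _).2 hv
      obtain ⟨b, hb⟩ := Finset.dvd_prod_of_mem (N g) (Finset.mem_univ W)
      rw [hb, pow_mul]
      exact K.pow_mem (hle (hN g W hbot)) b
    intro n hn
    exact finite_of_finite_quotient I _ fun a ha z => killsHomology_iff.1 ha n hn z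

end FreeAbelian

end ToricCover

end

theorem mainTheorem9 {V : Type*} [Fintype V] [LinearOrder V] (L : AbstractSimplicialComplex V)
    (r : ℕ) (ν : ToricCover.ToricGroup L →* Multiplicative (Fin r → ℤ))
    (hν : Function.Surjective ν) (k : Type*) [Field k] (q : ℕ) :
    (∀ i ≤ q, Module.Finite k ((ToricCover.toricCover ν).homology k i)) ↔
      ∀ W : Finset V,
        (∃ i ≤ q, ToricCover.aomotoBetti (ToricCover.ExteriorSR.component k L)
          (ToricCover.ExteriorSR.zW k L W) i ≠ 0) →
        LinearMap.range (ToricCover.H1.pullback ν) ⊓ ToricCover.coordSubspace L W = ⊥ :=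
  ToricCover.forall_finite_homology_iff ν hν k q
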